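/- For $n\ge 1$ and $\sigma\in\mathbb R$ let $$\mathrm{Ls}_n(\sigma)=-\int_0^\sigma \log^{n-1}\left|2\sin\tfrac{\theta}{2}\right|\,d\theta,\qquad \mathrm{Cl}_2(\sigma)=\sum_{n\ge1}\frac{\sin(n\sigma)}{n^2},\qquad \mathrm{Ti}_3(x)=\sum_{n\ge0}(-1)^n\frac{x^{2n+1}}{(2n+1)^3}\quad(|x|<1),$$ and let the second higher Mahler measure of $1+x+y$ be $$\mu_2(1+x+y)=\int_0^1\!\!\int_0^1 \log^2\left|1+e^{2\pi i t_1}+e^{2\pi i t_2}\right|\,dt_1\,dt_2 .$$ **Theorem.** The integrals defining $\mu_2(1+x+y)$ and $\mathrm{Ls}_3\left(\frac{2\pi}{3}\right)$ converge absolutely, and $$\mu_2(1+x+y)=\frac{24}{5\pi}\,\mathrm{Ti}_3\!\left(\frac1{\sqrt3}\right)+\frac{2\log 3}{\pi}\,\mathrm{Cl}_2\!\left(\frac{\pi}{3}\right)-\frac{\log^2 3}{10}-\frac{19\pi^2}{180} =\frac{\pi^2}{4}+\frac{3}{\pi}\,\mathrm{Ls}_3\!\left(\frac{2\pi}{3}\right).$$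 In particular $\mu_2(1+x+y)\neq\frac{5\pi^2}{54}$, a value that has been claimed in the literature. -/

import Mathlib

noncomputable section

/-- The integrand of the multiple Mahler measure of functions `P 0, …, P (k-1)` of `n` complex
variables: `∏ j, log |P j (e^{2πi t 0}, …, e^{2πi t (n-1)})|` at the point `t`. -/
def multipleMahlerIntegrand {k n : ℕ} (P : Fin k → (Fin n → ℂ) → ℂ) (t : Fin n → ℝ) : ℝ :=
  ∏ j, Real.log ‖P j (fun i => Complex.exp (2 * Real.pi * Complex.I * t i))‖

/-- The multiple Mahler measure `μ(P 0, …, P (k-1))`: the integral of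
`multipleMahlerIntegrand P` over the unit cube `[0,1]^n`. -/
def multipleMahler {k n : ℕ} (P : Fin k → (Fin n → ℂ) → ℂ) : ℝ :=
  ∫ t in Set.Icc (0 : Fin n → ℝ) 1, multipleMahlerIntegrand P t

/-- The higher Mahler measure `μ_k(P) = μ(P, …, P)`, with `P` repeated `k` times. -/
def higherMahler (k : ℕ) {n : ℕ} (P : (Fin n → ℂ) → ℂ) : ℝ :=
  multipleMahler (fun _ : Fin k => P)

/-- The function `1 + x + y` of two complex variables. -/
def oneAddXAddY (z : Fin 2 → ℂ) : ℂ := 1 + z 0 + z 1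

/-- The integrand `log^{n-1} |2 sin (θ/2)|` of the log-sine integral, for `n ≥ 1`. -/
def logSineIntegrand (n : ℕ) (θ : ℝ) : ℝ :=
  Real.log |2 * Real.sin (θ / 2)| ^ (n - 1)

/-- The log-sine integral `Ls_n(σ) = -∫_0^σ log^{n-1} |2 sin (θ/2)| dθ`, for `n ≥ 1`. -/
def logSine (n : ℕ) (σ : ℝ) : ℝ := -∫ θ in (0 : ℝ)..σ, logSineIntegrand n θ

/-- The inverse tangent integral of order `k`, `Ti_k(x) = ∑_{n ≥ 0} (-1)^n x^{2n+1} / (2n+1)^k`,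
on the interval `|x| < 1` of absolute convergence of its defining series. -/
def invTan (k : ℕ) (x : ℝ) : ℝ :=
  ∑' n : ℕ, (-1 : ℝ) ^ n * (x ^ (2 * n + 1) / (2 * (n : ℝ) + 1) ^ k)

/-- The Clausen function `Cl_2(σ) = ∑_{n ≥ 1} sin (n σ) / n^2`, written with `n + 1`, `n ≥ 0`. -/
def clausenTwo (σ : ℝ) : ℝ :=
  ∑' n : ℕ, Real.sin (((n : ℝ) + 1) * σ) / ((n : ℝ) + 1) ^ 2

theorem summable_invTan (k : ℕ) {x : ℝ} (hx : |x| < 1) :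
    Summable fun n : ℕ => (-1 : ℝ) ^ n * (x ^ (2 * n + 1) / (2 * (n : ℝ) + 1) ^ k) := by
  refine Summable.of_norm_bounded (summable_geometric_of_lt_one (abs_nonneg x) hx) ?_
  intro n
  have h1 : (1 : ℝ) ≤ (2 * (n : ℝ) + 1) ^ k := one_le_pow₀ (by linarith [n.cast_nonneg (α := ℝ)])
  rw [norm_mul, norm_pow, norm_neg, norm_one, one_pow, one_mul, norm_div, norm_pow,
    Real.norm_eq_abs, Real.norm_eq_abs, abs_of_nonneg (by linarith : (0 : ℝ) ≤ _ ^ k)]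
  exact (div_le_self (by positivity) h1).trans
    (pow_le_pow_of_le_one (abs_nonneg x) hx.le (by omega))

theorem summable_clausenTwo (σ : ℝ) :
    Summable fun n : ℕ => Real.sin (((n : ℝ) + 1) * σ) / ((n : ℝ) + 1) ^ 2 := by
  have h : Summable fun n : ℕ => 1 / (((n + 1 : ℕ) : ℝ)) ^ 2 :=
    (summable_nat_add_iff 1).2 (Real.summable_one_div_nat_pow.2 one_lt_two)
  refine Summable.of_norm_bounded h ?_
  intro n
  rw [norm_div, Real.norm_eq_abs, Real.norm_eq_abs, abs_of_nonneg (by positivity : (0 : ℝ) ≤ _ ^ 2)]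
  push_cast
  gcongr
  exact Real.abs_sin_le_one _

end

/-! ### Log-sine integrals: growth at the origin, reflection and duplication. -/

section LogSine

open Real MeasureTheory Set Filter Topology intervalIntegral

/-! Write ℓ, L, S for `logTwoSin`, `logTwoSinInt`, `logTwoSinSqInt`. Both closed forms come from
reducing everything to S(π/3).

Integrating over one variable first, the mean of log²|c + w| over |w| = 1 depends only on |c|.
Parseval applied to the series of log|1 + cw| gives Li₂(|c|²)/2 for |c| < 1, and factoring out c
handles |c| > 1 (`integral_log_norm_add_sq`). As |1 + e^{2πix}| = 2|cos πx|, the Mahler measure is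
2/π times the integral of `logSqMean (2 * sin φ)` over [0, π/2].

To evaluate it, deform: the mean M(φ, β) of log²|2 sin φ + 2 sin β · w| equals ℓ(φ)² at β = 0 and
`logSqMean (2 * sin φ)` at β = π/6, where 2 sin β = 1. Its β-derivative `mahlerKernel` is a
combination of ℓ(φ), ℓ(φ - β) and ℓ(φ + β) times cot β. By Fubini the φ-integral may be done first,
and it leaves (2L(2β) - 2L(β)) cot β. Integration by parts against ℓ(β), which vanishes at π/6,
together with ℓ(2β) = ℓ(β) + ℓ(π/2 - β), gives 3S(π/2) - 3S(π/3) in total (`integral_logSqMean`).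

The constants S(π/2) and S(π/6) are read off from a holomorphic primitive of log²(1 - z)/z along the
unit circle; at π/6 this uses e^{iπ/3} = 1 - e^{-iπ/3}. The log-sine form is then immediate.

For the other form, repeated integration by parts in x = tan u expresses Ti₃(1/√3) through log 3,
L(π/6), L(π/3) and the integral of log² tan over [0, π/6]. The duplication formula turns that
integral into S(π/6), S(π/2), S(π/3), while 3L(π/3) = 2L(π/6) and Cl₂(π/3) = -2L(π/6) cancel the
terms in L (`invTan_three_eq`). -/

/-- The function `u ↦ log |2 sin u|`. -/
noncomputable def logTwoSin (u : ℝ) : ℝ := log (2 * sin u)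

/-- The integral of `logTwoSin` from `0`. -/
noncomputable def logTwoSinInt (u : ℝ) : ℝ := ∫ v in (0 : ℝ)..u, logTwoSin v

/-- The integral of `logTwoSin ^ 2` from `0`. -/
noncomputable def logTwoSinSqInt (u : ℝ) : ℝ := ∫ v in (0 : ℝ)..u, logTwoSin v ^ 2

theorem measurable_logTwoSin : Measurable logTwoSin := by
  unfold logTwoSin; fun_prop

theorem logTwoSin_neg (u : ℝ) : logTwoSin (-u) = logTwoSin u := by
  simp [logTwoSin]

theorem logTwoSin_pi_sub (u : ℝ) : logTwoSin (π - u) = logTwoSin u := by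
  simp [logTwoSin]

theorem logTwoSin_pi_div_two_sub (u : ℝ) : logTwoSin (π / 2 - u) = log (2 * cos u) := by
  simp [logTwoSin, sin_pi_div_two_sub]

theorem logTwoSin_two_mul {u : ℝ} (h0 : 0 < u) (h1 : u < π / 2) :
    logTwoSin (2 * u) = logTwoSin u + logTwoSin (π / 2 - u) := by
  rw [logTwoSin_pi_div_two_sub, logTwoSin, logTwoSin, sin_two_mul, ← log_mul]
  · ring_nf
  · have := sin_pos_of_pos_of_lt_pi h0 (by linarith)
    positivity
  · have := cos_pos_of_mem_Ioo ⟨by linarith, h1⟩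
    positivity

theorem logTwoSin_pi_div_six : logTwoSin (π / 6) = 0 := by
  simp [logTwoSin]

theorem hasDerivAt_logTwoSin {u : ℝ} (h : sin u ≠ 0) :
    HasDerivAt logTwoSin (cos u / sin u) u := by
  have := ((hasDerivAt_sin u).const_mul 2).log (by simpa using h)
  rwa [mul_div_mul_left _ _ two_ne_zero] at this

theorem continuousAt_logTwoSin {u : ℝ} (h : sin u ≠ 0) : ContinuousAt logTwoSin u :=
  (hasDerivAt_logTwoSin h).continuousAt

/-- The exponent 1/4 is small enough that the square of the bound is still integrable at 0 and that
L(u)ℓ(u) is O(u^{1/2}). -/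
theorem abs_logTwoSin_le {u : ℝ} (h0 : 0 < u) (h1 : u ≤ π / 2) :
    |logTwoSin u| ≤ 5 * u ^ (-(1 / 4) : ℝ) := by
  have hs := mul_le_sin h0.le h1
  have hpi := pi_lt_four
  have hp := pi_pos
  have h2 : u ≤ 2 * sin u := by
    have : u / 2 ≤ 2 / π * u := by
      rw [div_mul_eq_mul_div, div_le_div_iff₀ (by norm_num) hp]
      nlinarith
    linarith
  have hlow : log u ≤ logTwoSin u := log_le_log h0 h2
  have hup : logTwoSin u ≤ log 2 :=
    log_le_log (by linarith) (by linarith [sin_le_one u])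
  have hl2 : log 2 < 1 := by linarith [log_two_lt_d9]
  have key : -log u ≤ 4 * u ^ (-(1 / 4) : ℝ) := by
    have := log_le_rpow_div (x := u⁻¹) (by positivity) (show (0 : ℝ) < 1 / 4 by norm_num)
    rw [log_inv, inv_rpow h0.le, ← rpow_neg h0.le] at this
    linarith
  have hpow : (1 : ℝ) / 2 ≤ u ^ (-(1 / 4) : ℝ) := by
    -- Since u ≤ π/2 < 16, the value 16^{-1/4} = 1/2 bounds u^{-1/4} below; this absorbs the upper
    -- bound log 2 < 1 into the same power.
    have h16 : (16 : ℝ) ^ (-(1 / 4) : ℝ) = 1 / 2 := by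
      rw [show (16 : ℝ) = 2 ^ (4 : ℝ) by norm_num, ← rpow_mul (by norm_num)]
      norm_num [rpow_neg_one]
    rw [← h16]
    exact rpow_le_rpow_of_nonpos h0 (by linarith) (by norm_num)
  rw [abs_le]
  constructor <;> linarith

theorem intervalIntegrable_logTwoSin (a b : ℝ) : IntervalIntegrable logTwoSin volume a b := by
  have h : MeromorphicOn (fun u : ℝ => 2 * sin u) (uIcc a b) := by
    intro x _
    fun_prop
  exact h.intervalIntegrable_log

theorem sq_logTwoSin_le {u : ℝ} (h0 : 0 < u) (h1 : u ≤ π / 2) :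
    logTwoSin u ^ 2 ≤ 25 * u ^ (-(1 / 2) : ℝ) := by
  rw [← sq_abs]
  calc _ ≤ (5 * u ^ (-(1 / 4) : ℝ)) ^ 2 := by gcongr; exact abs_logTwoSin_le h0 h1
    _ = 25 * u ^ (-(1 / 2) : ℝ) := by
      rw [mul_pow, ← rpow_natCast (u ^ _), ← rpow_mul h0.le]
      norm_num

theorem intervalIntegrable_sq_logTwoSin_pi_div_two :
    IntervalIntegrable (fun u => logTwoSin u ^ 2) volume 0 (π / 2) := by
  have hp := pi_pos
  refine ((intervalIntegrable_rpow' (r := -(1 / 2)) (by norm_num)).const_mul 25).mono_fun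
    (measurable_logTwoSin.pow_const 2).aestronglyMeasurable ?_
  rw [uIoc_of_le (by linarith)]
  filter_upwards [ae_restrict_mem measurableSet_Ioc] with u hu
  rw [norm_of_nonneg (sq_nonneg _), norm_of_nonneg (by have := hu.1; positivity)]
  exact sq_logTwoSin_le hu.1 hu.2

theorem intervalIntegrable_sq_logTwoSin {a b : ℝ} (ha : 0 ≤ a) (hab : a ≤ b) (hb : b ≤ π) :
    IntervalIntegrable (fun u => logTwoSin u ^ 2) volume a b := by
  have hp := pi_pos
  have h1 := intervalIntegrable_sq_logTwoSin_pi_div_two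
  have h2 : IntervalIntegrable (fun u => logTwoSin u ^ 2) volume (π / 2) π := by
    have := (h1.comp_sub_left π).symm
    simp only [logTwoSin_pi_sub, sub_zero] at this
    convert this using 2
    ring
  refine (h1.trans h2).mono_set ?_
  rw [uIcc_of_le hab, uIcc_of_le hp.le]
  exact Icc_subset_Icc ha hb

theorem logTwoSinInt_sub (a b : ℝ) :
    ∫ v in a..b, logTwoSin v = logTwoSinInt b - logTwoSinInt a :=
  (integral_interval_sub_left (intervalIntegrable_logTwoSin _ _)
    (intervalIntegrable_logTwoSin _ _)).symm

theorem logTwoSinSqInt_sub {a b : ℝ} (ha : 0 ≤ a) (hab : a ≤ b) (hb : b ≤ π) :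
    ∫ v in a..b, logTwoSin v ^ 2 = logTwoSinSqInt b - logTwoSinSqInt a :=
  (integral_interval_sub_left (intervalIntegrable_sq_logTwoSin le_rfl (ha.trans hab) hb)
    (intervalIntegrable_sq_logTwoSin le_rfl ha (hab.trans hb))).symm

/-- With a = ℓ(u), c = ℓ(π/2 - u) and d = ℓ(2u) = a + c, every cross term met later can be rewritten
through a², c², d². This and the next lemma integrate c² and d². -/
theorem integral_logTwoSin_sq_pi_div_two_sub :
    IntervalIntegrable (fun u => logTwoSin (π / 2 - u) ^ 2) volume 0 (π / 6) ∧
      ∫ u in (0 : ℝ)..π / 6, logTwoSin (π / 2 - u) ^ 2 =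
        logTwoSinSqInt (π / 2) - logTwoSinSqInt (π / 3) := by
  have hp := pi_pos
  constructor
  · have := (intervalIntegrable_sq_logTwoSin (a := π / 3) (b := π / 2) (by linarith) (by linarith)
      (by linarith)).symm.comp_sub_left (π / 2)
    convert this using 2 <;> ring
  · rw [integral_comp_sub_left (fun u => logTwoSin u ^ 2),
      show π / 2 - π / 6 = π / 3 by ring, sub_zero,
      logTwoSinSqInt_sub (by linarith) (by linarith) (by linarith)]

theorem integral_logTwoSin_sq_two_mul :
    IntervalIntegrable (fun u => logTwoSin (2 * u) ^ 2) volume 0 (π / 6) ∧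
      ∫ u in (0 : ℝ)..π / 6, logTwoSin (2 * u) ^ 2 = logTwoSinSqInt (π / 3) / 2 := by
  have hp := pi_pos
  constructor
  · have := (intervalIntegrable_sq_logTwoSin (a := 0) (b := π / 3) le_rfl (by linarith)
      (by linarith)).comp_mul_left (c := 2)
    rwa [zero_div, show π / 3 / 2 = π / 6 by ring] at this
  · rw [integral_comp_mul_left (fun u => logTwoSin u ^ 2) two_ne_zero,
      show 2 * (π / 6) = π / 3 by ring, mul_zero, smul_eq_mul, logTwoSinSqInt]
    ring

theorem logTwoSinInt_pi_div_two : logTwoSinInt (π / 2) = 0 := by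
  have hp := pi_pos
  have : ∫ v in (0 : ℝ)..π / 2, logTwoSin v = ∫ v in (0 : ℝ)..π / 2, (log 2 + log (sin v)) := by
    refine integral_congr_ae (Eventually.of_forall fun v hv => ?_)
    rw [uIoc_of_le (by linarith)] at hv
    exact log_mul two_ne_zero (sin_pos_of_pos_of_lt_pi hv.1 (by linarith [hv.2])).ne'
  rw [logTwoSinInt, this, intervalIntegral.integral_add (by simp) (by apply intervalIntegrable_log_sin),
    integral_log_sin_zero_pi_div_two]
  simp
  ring

theorem logTwoSinInt_neg (u : ℝ) : logTwoSinInt (-u) = -logTwoSinInt u := by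
  have := integral_comp_neg (a := 0) (b := u) logTwoSin
  simp only [logTwoSin_neg, neg_zero] at this
  rw [logTwoSinInt, integral_symm, logTwoSinInt, this]

theorem logTwoSinInt_pi_sub (u : ℝ) : logTwoSinInt (π - u) = -logTwoSinInt u := by
  have h1 := integral_comp_sub_left (a := π / 2) (b := u) logTwoSin π
  simp only [logTwoSin_pi_sub] at h1
  rw [logTwoSinInt_sub, logTwoSinInt_sub, logTwoSinInt_pi_div_two,
    show π - π / 2 = π / 2 by ring, logTwoSinInt_pi_div_two] at h1
  linarith

theorem integral_logTwoSin_pi_div_two_sub (u : ℝ) :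
    ∫ v in (0 : ℝ)..u, logTwoSin (π / 2 - v) = -logTwoSinInt (π / 2 - u) := by
  rw [integral_comp_sub_left logTwoSin, logTwoSinInt_sub, sub_zero, logTwoSinInt_pi_div_two]
  ring

theorem logTwoSinInt_two_mul {u : ℝ} (h0 : 0 ≤ u) (h1 : u ≤ π / 2) :
    logTwoSinInt (2 * u) = 2 * logTwoSinInt u - 2 * logTwoSinInt (π / 2 - u) := by
  have h2 : ∫ v in (0 : ℝ)..u, logTwoSin (2 * v) =
      ∫ v in (0 : ℝ)..u, (logTwoSin v + logTwoSin (π / 2 - v)) := by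
    rw [integral_of_le h0, integral_of_le h0, integral_Ioc_eq_integral_Ioo,
      integral_Ioc_eq_integral_Ioo]
    exact setIntegral_congr_fun measurableSet_Ioo fun v hv =>
      logTwoSin_two_mul hv.1 (hv.2.trans_le h1)
  rw [integral_comp_mul_left logTwoSin two_ne_zero, intervalIntegral.integral_add
    (intervalIntegrable_logTwoSin _ _)
    (by simpa using (intervalIntegrable_logTwoSin (π / 2) (π / 2 - u)).comp_sub_left (π / 2)),
    integral_logTwoSin_pi_div_two_sub, mul_zero] at h2
  simp only [smul_eq_mul] at h2
  change 2⁻¹ * logTwoSinInt (2 * u) = logTwoSinInt u + _ at h2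
  linarith

/-- At u = π/6 the duplication formula closes up, because 2u and π/2 - u are both π/3. -/
theorem three_mul_logTwoSinInt_pi_div_three :
    3 * logTwoSinInt (π / 3) = 2 * logTwoSinInt (π / 6) := by
  have hp := pi_pos
  have := logTwoSinInt_two_mul (u := π / 6) (by linarith) (by linarith)
  rw [show 2 * (π / 6) = π / 3 by ring, show π / 2 - π / 6 = π / 3 by ring] at this
  linarith

theorem continuous_logTwoSinInt : Continuous logTwoSinInt :=
  continuous_primitive (fun _ _ => intervalIntegrable_logTwoSin _ _) 0

theorem hasDerivAt_logTwoSinInt {u : ℝ} (h : sin u ≠ 0) :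
    HasDerivAt logTwoSinInt (logTwoSin u) u :=
  integral_hasDerivAt_right (intervalIntegrable_logTwoSin _ _)
    measurable_logTwoSin.stronglyMeasurable.stronglyMeasurableAtFilter
    (continuousAt_logTwoSin h)

theorem abs_logTwoSinInt_le {u : ℝ} (h0 : 0 < u) (h1 : u ≤ π / 2) :
    |logTwoSinInt u| ≤ 20 / 3 * u ^ (3 / 4 : ℝ) := by
  have h := norm_integral_le_of_norm_le (f := logTwoSin) (μ := volume) h0.le
    (g := fun v => 5 * v ^ (-(1 / 4) : ℝ))
    (Eventually.of_forall fun v hv => abs_logTwoSin_le hv.1 (hv.2.trans h1))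
    ((intervalIntegrable_rpow' (by norm_num)).const_mul 5)
  rw [intervalIntegral.integral_const_mul, integral_rpow (Or.inl (by norm_num))] at h
  refine h.trans_eq ?_
  norm_num
  ring

theorem tendsto_logTwoSinInt_mul_logTwoSin :
    Tendsto (fun u => logTwoSinInt u * logTwoSin u) (𝓝[>] 0) (𝓝 0) := by
  have hp := pi_pos
  have hlim : Tendsto (fun u : ℝ => 100 / 3 * u ^ (1 / 2 : ℝ)) (𝓝[>] 0) (𝓝 0) := by
    have : ContinuousAt (fun u : ℝ => 100 / 3 * u ^ (1 / 2 : ℝ)) 0 :=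
      (continuousAt_rpow_const _ _ (Or.inr (by norm_num))).const_mul _
    have := this.tendsto
    norm_num at this
    exact (by simpa using this : Tendsto _ _ _).mono_left nhdsWithin_le_nhds
  refine squeeze_zero_norm' ?_ hlim
  filter_upwards [Ioo_mem_nhdsGT (show (0 : ℝ) < π / 2 by linarith)] with u hu
  rw [norm_mul]
  calc _ ≤ (20 / 3 * u ^ (3 / 4 : ℝ)) * (5 * u ^ (-(1 / 4) : ℝ)) :=
        mul_le_mul (abs_logTwoSinInt_le hu.1 hu.2.le) (abs_logTwoSin_le hu.1 hu.2.le)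
          (abs_nonneg _) (by have := hu.1; positivity)
    _ = 100 / 3 * (u ^ (3 / 4 : ℝ) * u ^ (-(1 / 4) : ℝ)) := by ring
    _ = _ := by rw [← rpow_add hu.1]; norm_num

end LogSine

/-! ### Termwise differentiation and the dilogarithm. -/

section PowerSeries

open Real MeasureTheory Set Filter Topology intervalIntegral

/-- On a disc of radius r < 1 the differentiated terms are dominated by r^n. The hypotheses are
chosen to fit both the dilogarithm and the inverse tangent integrals. -/
theorem hasDerivAt_tsum_mul_pow {c : ℕ → ℝ} {k : ℕ → ℕ} (hk : ∀ n, n + 1 ≤ k n)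
    (hc : ∀ n, |c n| * k n ≤ 1) {x : ℝ} (hx : |x| < 1) :
    HasDerivAt (fun y => ∑' n, c n * y ^ k n) (∑' n, c n * (k n * x ^ (k n - 1))) x := by
  obtain ⟨r, hxr, hr1⟩ := exists_between hx
  have hr0 : 0 ≤ r := (abs_nonneg x).trans hxr.le
  refine hasDerivAt_tsum_of_isPreconnected (u := fun n => r ^ n) (t := Metric.ball 0 r)
    (g := fun n y => c n * y ^ k n) (g' := fun n y => c n * (k n * y ^ (k n - 1)))
    (y₀ := 0) (summable_geometric_of_lt_one hr0 hr1) Metric.isOpen_ball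
    (convex_ball _ _).isPreconnected (fun n y _ => (hasDerivAt_pow _ _).const_mul _) ?_ ?_ ?_ ?_
  · intro n y hy
    have hy' : |y| ≤ r := by simpa using (mem_ball_zero_iff.1 hy).le
    rw [norm_mul, norm_mul, norm_pow, ← mul_assoc, Real.norm_natCast, Real.norm_eq_abs,
      Real.norm_eq_abs]
    calc _ ≤ 1 * |y| ^ (k n - 1) := by gcongr; exact hc n
      _ ≤ r ^ (k n - 1) := by rw [one_mul]; gcongr
      _ ≤ r ^ n := pow_le_pow_of_le_one hr0 hr1.le (by have := hk n; omega)
  · simpa using (abs_nonneg x).trans_lt hxr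
  · refine summable_zero.congr fun n => ?_
    rw [zero_pow (by have := hk n; omega), mul_zero]
  · simpa using hxr

/-- The function `a ↦ Li₂(a²) / 2` on `[-1, 1]`. -/
noncomputable def halfDilogSq (a : ℝ) : ℝ :=
  ∑' n : ℕ, 1 / (2 * ((n : ℝ) + 1) ^ 2) * a ^ (2 * n + 2)

theorem summable_one_div_two_mul_sq :
    Summable fun n : ℕ => 1 / (2 * ((n : ℝ) + 1) ^ 2) := by
  have h : Summable fun n : ℕ => 1 / (((n + 1 : ℕ) : ℝ)) ^ 2 :=
    (summable_nat_add_iff 1).2 (Real.summable_one_div_nat_pow.2 one_lt_two)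
  refine (h.mul_left (1 / 2)).congr fun n => ?_
  push_cast
  field_simp

theorem norm_halfDilogSq_term_le (n : ℕ) {a : ℝ} (ha : |a| ≤ 1) :
    ‖1 / (2 * ((n : ℝ) + 1) ^ 2) * a ^ (2 * n + 2)‖ ≤ 1 / (2 * ((n : ℝ) + 1) ^ 2) := by
  rw [norm_mul, norm_pow, Real.norm_eq_abs a, norm_of_nonneg (by positivity)]
  exact mul_le_of_le_one_right (by positivity) (pow_le_one₀ (abs_nonneg _) ha)

theorem continuousOn_halfDilogSq : ContinuousOn halfDilogSq (Icc 0 1) :=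
  continuousOn_tsum (fun _ => by fun_prop) summable_one_div_two_mul_sq fun n _ hx =>
    norm_halfDilogSq_term_le n (abs_le.2 ⟨by linarith [hx.1], hx.2⟩)

theorem halfDilogSq_zero : halfDilogSq 0 = 0 := by
  simp [halfDilogSq]

theorem halfDilogSq_nonneg {a : ℝ} (ha : 0 ≤ a) : 0 ≤ halfDilogSq a :=
  tsum_nonneg fun n => by positivity

theorem halfDilogSq_le_halfDilogSq_one {a : ℝ} (h0 : 0 ≤ a) (h1 : a ≤ 1) :
    halfDilogSq a ≤ halfDilogSq 1 := by
  have hs : ∀ b : ℝ, |b| ≤ 1 →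
      Summable fun n : ℕ => 1 / (2 * ((n : ℝ) + 1) ^ 2) * b ^ (2 * n + 2) := fun b hb =>
    Summable.of_norm_bounded summable_one_div_two_mul_sq fun n => norm_halfDilogSq_term_le n hb
  refine (hs a (abs_le.2 ⟨by linarith, h1⟩)).tsum_le_tsum (fun n => ?_) (hs 1 (by simp))
  gcongr

theorem hasDerivAt_halfDilogSq {a : ℝ} (h0 : 0 < a) (h1 : a < 1) :
    HasDerivAt halfDilogSq (-log (1 - a ^ 2) / a) a := by
  have h := hasDerivAt_tsum_mul_pow (c := fun n : ℕ => 1 / (2 * ((n : ℝ) + 1) ^ 2))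
    (k := fun n => 2 * n + 2) (x := a) (fun n => by omega) (fun n => by
      rw [abs_of_nonneg (by positivity)]
      push_cast
      rw [div_mul_eq_mul_div, div_le_one (by positivity)]
      nlinarith [n.cast_nonneg (α := ℝ)]) (by rwa [abs_of_pos h0])
  refine h.congr_deriv ?_
  have h2 : |a ^ 2| < 1 := by rw [abs_of_nonneg (sq_nonneg a)]; nlinarith
  rw [← ((hasSum_pow_div_log_of_abs_lt_one h2).div_const a).tsum_eq]
  refine tsum_congr fun n => ?_
  have : 2 * n + 2 - 1 = 2 * n + 1 := by omega
  rw [this]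
  push_cast
  field_simp
  ring

end PowerSeries

/-! ### The mean of log²|c + w| over the unit circle. -/

section CircleMean

open Real MeasureTheory Set Filter Topology intervalIntegral

theorem integral_cos_int_mul {k : ℤ} (hk : k ≠ 0) (α : ℝ) :
    ∫ y in (0 : ℝ)..1, cos (k * (α + 2 * π * y)) = 0 := by
  have hk' : (k : ℝ) * (2 * π) ≠ 0 := by have := pi_pos; positivity
  have h : ∀ y : ℝ, k * (α + 2 * π * y) = (k * (2 * π)) * y + k * α := fun y => by ring
  simp only [h]
  rw [integral_comp_mul_add cos hk', integral_cos]
  have : sin (k * (2 * π) * 1 + k * α) = sin (k * α) := by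
    rw [mul_one, add_comm, sin_add_int_mul_two_pi]
  rw [this]
  simp

theorem integral_cos_nat_mul_cos_nat (n m : ℕ) (hn : n ≠ 0) (α : ℝ) :
    ∫ y in (0 : ℝ)..1, cos (n * (α + 2 * π * y)) * cos (m * (α + 2 * π * y)) =
      if n = m then 1 / 2 else 0 := by
  have h : ∀ y : ℝ, cos (n * (α + 2 * π * y)) * cos (m * (α + 2 * π * y)) =
      1 / 2 * cos (((n - m : ℤ) : ℝ) * (α + 2 * π * y)) +
      1 / 2 * cos (((n + m : ℤ) : ℝ) * (α + 2 * π * y)) := fun y => by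
    push_cast
    rw [sub_mul, add_mul, cos_sub, cos_add]
    ring
  simp only [h]
  rw [intervalIntegral.integral_add (Continuous.intervalIntegrable (by fun_prop) _ _)
      (Continuous.intervalIntegrable (by fun_prop) _ _),
    intervalIntegral.integral_const_mul, intervalIntegral.integral_const_mul,
    integral_cos_int_mul (k := n + m) (by omega)]
  split_ifs with hnm
  · subst hnm; simp
  · rw [integral_cos_int_mul (by omega)]; simp

theorem hasSum_integral_mul_cos {b : ℕ → ℝ} (hb : Summable fun n => |b n|) (α : ℝ) {g f : ℝ → ℝ}
    (hg : Continuous g) (hf : ∀ y, HasSum (fun n : ℕ => b n * cos (n * (α + 2 * π * y))) (f y)) :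
    HasSum (fun n : ℕ => b n * ∫ y in (0 : ℝ)..1, cos (n * (α + 2 * π * y)) * g y)
      (∫ y in (0 : ℝ)..1, f y * g y) := by
  obtain ⟨C, hC⟩ := isCompact_Icc.exists_bound_of_continuousOn (s := Icc (0 : ℝ) 1) hg.continuousOn
  simp only [← intervalIntegral.integral_const_mul]
  refine intervalIntegral.hasSum_integral_of_dominated_convergence (fun n _ => |b n| * C) (fun n =>
    Continuous.aestronglyMeasurable (by fun_prop)) (fun n => Eventually.of_forall fun y hy => ?_)
    (Eventually.of_forall fun y _ => hb.mul_right C) (by simp)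
    (Eventually.of_forall fun y _ => by simpa [mul_assoc] using (hf y).mul_right (g y))
  rw [uIoc_of_le zero_le_one] at hy
  rw [norm_mul, norm_mul, Real.norm_eq_abs, Real.norm_eq_abs (cos _)]
  have := hC y ⟨hy.1.le, hy.2⟩
  gcongr
  calc _ ≤ 1 * C := mul_le_mul (abs_cos_le_one _) this (norm_nonneg _) zero_le_one
    _ = C := one_mul C

/-- Parseval for an absolutely convergent cosine series: integrating the series against f, and each
cosine against the series, leaves only the diagonal terms. The phase α allows for the argument of c.
-/
theorem hasSum_integral_sq_cos_series {b : ℕ → ℝ} (hb : Summable fun n => |b n|) (hb0 : b 0 = 0)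
    (α : ℝ) {f : ℝ → ℝ} (hfc : Continuous f)
    (hf : ∀ y, HasSum (fun n : ℕ => b n * cos (n * (α + 2 * π * y))) (f y)) :
    HasSum (fun n : ℕ => b n ^ 2 / 2) (∫ y in (0 : ℝ)..1, f y ^ 2) ∧
      ∫ y in (0 : ℝ)..1, f y = 0 := by
  constructor
  · have h1 := hasSum_integral_mul_cos hb α hfc hf
    simp only [← sq] at h1
    refine h1.congr_fun fun n => ?_
    rcases eq_or_ne n 0 with rfl | hn
    · simp [hb0]
    have h2 := hasSum_integral_mul_cos hb α (g := fun y => cos (n * (α + 2 * π * y)))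
      (by fun_prop) hf
    have h3 : HasSum (fun m : ℕ => b m * ∫ y in (0 : ℝ)..1, cos (m * (α + 2 * π * y)) *
        cos (n * (α + 2 * π * y))) (b n / 2) := by
      convert hasSum_ite_eq n (b n / 2) using 2 with m
      simp only [mul_comm (cos ((_ : ℕ) * _)) (cos (n * _)), integral_cos_nat_mul_cos_nat n _ hn]
      rcases eq_or_ne n m with rfl | hnm
      · simp; ring
      · simp [hnm, hnm.symm]
    have h4 := h2.unique h3
    simp only [mul_comm (f _)] at h4
    rw [h4]
    ring
  · have h1 := hasSum_integral_mul_cos hb α (g := fun _ => 1) continuous_const hf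
    simp only [mul_one] at h1
    refine h1.unique (hasSum_zero.congr_fun fun n => ?_)
    rcases eq_or_ne n 0 with rfl | hn
    · simp [hb0]
    · have := integral_cos_int_mul (k := n) (by exact_mod_cast hn) α
      simp only [Int.cast_natCast] at this
      rw [this, mul_zero]

/-- The point `exp (2πiy)` of the unit circle. -/
noncomputable def unitExp (y : ℝ) : ℂ := Complex.exp (2 * π * Complex.I * y)

theorem unitExp_eq (y : ℝ) : unitExp y = Complex.exp ((2 * π * y : ℝ) * Complex.I) := by
  rw [unitExp]; push_cast; ring_nf

theorem norm_unitExp (y : ℝ) : ‖unitExp y‖ = 1 := by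
  rw [unitExp_eq, Complex.norm_exp_ofReal_mul_I]

theorem continuous_unitExp : Continuous unitExp := by
  unfold unitExp; fun_prop

/-- The real part of the Taylor series of log(1 + cw) is a cosine series with coefficients ±|c|^n/n
and no constant term, so its mean is 0 and Parseval applies. -/
theorem integral_log_norm_one_add {c : ℂ} (hc : ‖c‖ < 1) :
    ∫ y in (0 : ℝ)..1, log ‖1 + c * unitExp y‖ ^ 2 = halfDilogSq ‖c‖ ∧
      ∫ y in (0 : ℝ)..1, log ‖1 + c * unitExp y‖ = 0 := by
  have hlt : ∀ y, ‖c * unitExp y‖ < 1 := fun y => by rwa [norm_mul, norm_unitExp, mul_one]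
  have hne : ∀ y, ‖1 + c * unitExp y‖ ≠ 0 := fun y h0 => by
    rw [norm_eq_zero] at h0
    have : c * unitExp y = -1 := by linear_combination h0
    have h1 := hlt y
    rw [this] at h1
    simp at h1
  have hcont : Continuous fun y => log ‖1 + c * unitExp y‖ :=
    Continuous.log (by have := continuous_unitExp; fun_prop) hne
  set b : ℕ → ℝ := fun n => (-1) ^ (n + 1) * ‖c‖ ^ n / n with hbdef
  have hb : Summable fun n => |b n| := by
    refine (summable_geometric_of_lt_one (norm_nonneg c) hc).of_nonneg_of_le
      (fun _ => abs_nonneg _) fun n => ?_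
    simp only [hbdef]
    rw [abs_div, abs_mul, abs_pow, abs_neg, abs_one, one_pow, one_mul, Nat.abs_cast,
      abs_of_nonneg (by positivity)]
    rcases Nat.eq_zero_or_pos n with rfl | hn
    · simp
    · exact div_le_self (by positivity) (by exact_mod_cast hn)
  have hf : ∀ y, HasSum (fun n : ℕ => b n * cos (n * (c.arg + 2 * π * y)))
      (log ‖1 + c * unitExp y‖) := fun y => by
    have h := Complex.hasSum_re (Complex.hasSum_taylorSeries_log (hlt y))
    rw [Complex.log_re] at h
    refine h.congr_fun fun n => ?_
    have hz : c * unitExp y = ‖c‖ * Complex.exp ((c.arg + 2 * π * y : ℝ) * Complex.I) := by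
      conv_lhs => rw [← Complex.norm_mul_exp_arg_mul_I c]
      rw [unitExp_eq, mul_assoc, ← Complex.exp_add]
      push_cast; ring_nf
    have : (-1 : ℂ) ^ (n + 1) * (c * unitExp y) ^ n / n =
        (b n : ℝ) * Complex.exp ((n * (c.arg + 2 * π * y) : ℝ) * Complex.I) := by
      rw [hz, mul_pow, ← Complex.exp_nat_mul]
      simp only [hbdef]
      push_cast
      rw [← mul_assoc (n : ℂ)]
      ring
    rw [this, Complex.re_ofReal_mul, Complex.exp_ofReal_mul_I_re]
  obtain ⟨h1, h2⟩ := hasSum_integral_sq_cos_series hb (by simp [hbdef]) c.arg hcont hf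
  refine ⟨?_, h2⟩
  rw [← h1.tsum_eq, h1.summable.tsum_eq_zero_add, halfDilogSq]
  simp only [hbdef]
  -- The coefficient at n = 0 is a division by zero, hence 0, and the sum may start at n = 1.
  rw [show ((-1 : ℝ) ^ (0 + 1) * ‖c‖ ^ 0 / ((0 : ℕ) : ℝ)) ^ 2 / 2 = 0 by simp, zero_add]
  refine tsum_congr fun n => ?_
  rw [div_pow, mul_pow, ← pow_mul, mul_comm (n + 1 + 1) 2, pow_mul]
  push_cast
  field_simp
  ring_nf

/-- The mean of `log² |c + w|` over the unit circle `|w| = 1`, as a function of `|c|`. -/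
noncomputable def logSqMean (a : ℝ) : ℝ :=
  if a ≤ 1 then halfDilogSq a else log a ^ 2 + halfDilogSq (1 / a)

/-- For |c| < 1, |c + w| = |1 + c̄w| on |w| = 1. For |c| > 1 factor out c; the cross term drops
because log|1 + w/c| has mean zero. -/
theorem integral_log_norm_add_sq {c : ℂ} (hc : ‖c‖ ≠ 1) :
    ∫ y in (0 : ℝ)..1, log ‖c + unitExp y‖ ^ 2 = logSqMean ‖c‖ := by
  rcases lt_or_gt_of_ne hc with h | h
  · rw [logSqMean, if_pos h.le]
    have hc' : ‖(starRingEnd ℂ) c‖ < 1 := by rwa [RCLike.norm_conj]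
    have := (integral_log_norm_one_add hc').1
    rw [RCLike.norm_conj] at this
    rw [← this]
    congr 1
    ext y
    have h1 : (starRingEnd ℂ) (unitExp y) * unitExp y = 1 := by
      rw [mul_comm, Complex.mul_conj, Complex.normSq_eq_norm_sq, norm_unitExp]; simp
    have h2 : 1 + (starRingEnd ℂ) c * unitExp y = (starRingEnd ℂ) (c + unitExp y) * unitExp y := by
      rw [map_add, add_mul, h1, add_comm]
    rw [h2, norm_mul, norm_unitExp, mul_one, RCLike.norm_conj]
  · rw [logSqMean, if_neg (not_le.2 h)]
    have hc0 : c ≠ 0 := fun h0 => by simp [h0] at h; linarith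
    have hc' : ‖c⁻¹‖ < 1 := by rw [norm_inv]; exact inv_lt_one_of_one_lt₀ h
    have hne : ∀ y, ‖1 + c⁻¹ * unitExp y‖ ≠ 0 := fun y h0 => by
      rw [norm_eq_zero] at h0
      have : c⁻¹ * unitExp y = -1 := by linear_combination h0
      have h1 := congrArg norm this
      rw [norm_mul, norm_unitExp, mul_one, norm_neg, norm_one] at h1
      linarith
    have hcont : Continuous fun y => log ‖1 + c⁻¹ * unitExp y‖ :=
      Continuous.log (by have := continuous_unitExp; fun_prop) hne
    have h2 : ∀ y, log ‖c + unitExp y‖ ^ 2 = log ‖c‖ ^ 2 +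
        (2 * log ‖c‖ * log ‖1 + c⁻¹ * unitExp y‖ + log ‖1 + c⁻¹ * unitExp y‖ ^ 2) := fun y => by
      have : c + unitExp y = c * (1 + c⁻¹ * unitExp y) := by field_simp
      rw [this, norm_mul, log_mul (norm_ne_zero_iff.2 hc0) (hne y)]
      ring
    obtain ⟨h3, h4⟩ := integral_log_norm_one_add hc'
    simp only [h2]
    rw [intervalIntegral.integral_add (by simp)
        (Continuous.intervalIntegrable (by fun_prop) _ _),
      intervalIntegral.integral_add (Continuous.intervalIntegrable (by fun_prop) _ _)
        (Continuous.intervalIntegrable (by fun_prop) _ _),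
      intervalIntegral.integral_const_mul, h3, h4, norm_inv]
    simp

end CircleMean

/-! ### Reduction of the double integral to a single one. -/

section Torus

open Real MeasureTheory Set Filter Topology intervalIntegral

theorem multipleMahlerIntegrand_oneAddXAddY (t : Fin 2 → ℝ) :
    multipleMahlerIntegrand (fun _ : Fin 2 => oneAddXAddY) t =
      log ‖1 + unitExp (t 0) + unitExp (t 1)‖ ^ 2 := by
  simp [multipleMahlerIntegrand, oneAddXAddY, unitExp]

theorem norm_one_add_unitExp (x : ℝ) : ‖1 + unitExp x‖ = 2 * |cos (π * x)| := by
  have h : 1 + unitExp x = (2 * cos (π * x) : ℝ) * Complex.exp ((π * x : ℝ) * Complex.I) := by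
    push_cast
    rw [Complex.two_cos, unitExp, add_mul, ← Complex.exp_add, ← Complex.exp_add, add_comm]
    ring_nf
    simp [add_comm]
  rw [h, norm_mul, Complex.norm_exp_ofReal_mul_I, mul_one, Complex.norm_real, norm_mul]
  simp

theorem ae_norm_one_add_unitExp_ne_one : ∀ᵐ x : ℝ, ‖1 + unitExp x‖ ≠ 1 := by
  have hsub : {x : ℝ | ‖1 + unitExp x‖ = 1} ⊆
      (⋃ k : ℤ, {(k : ℝ) + 1 / 3}) ∪ ⋃ k : ℤ, {(k : ℝ) - 1 / 3} := by
    intro x hx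
    rw [mem_ofPred_eq, norm_one_add_unitExp] at hx
    -- Doubling the angle removes the absolute value: |cos πx| = 1/2 becomes cos 2πx = -1/2, whose
    -- solutions are countable.
    have h1 : cos (2 * π / 3) = cos (2 * π * x) := by
      rw [show 2 * π / 3 = 2 * (π / 3) by ring, show 2 * π * x = 2 * (π * x) by ring, cos_two_mul,
        cos_two_mul, cos_pi_div_three, ← sq_abs (cos (π * x)),
        show |cos (π * x)| = 1 / 2 by linarith]
    have hp := pi_ne_zero
    obtain ⟨k, hk | hk⟩ := cos_eq_cos_iff.1 h1
    · refine Or.inl (mem_iUnion.2 ⟨k, ?_⟩)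
      rw [mem_singleton_iff]
      field_simp at hk ⊢
      linarith
    · refine Or.inr (mem_iUnion.2 ⟨k, ?_⟩)
      rw [mem_singleton_iff]
      field_simp at hk ⊢
      linarith
  rw [ae_iff]
  simp only [not_not]
  exact ((((countable_iUnion fun _ => countable_singleton _).union
    (countable_iUnion fun _ => countable_singleton _))).mono hsub).measure_zero _

theorem continuous_log_norm_add_unitExp {c : ℂ} (hc : ‖c‖ ≠ 1) :
    Continuous fun y => log ‖c + unitExp y‖ := by
  refine Continuous.log (by have := continuous_unitExp; fun_prop) fun y h0 => hc ?_
  rw [norm_eq_zero, add_eq_zero_iff_eq_neg] at h0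
  rw [h0, norm_neg, norm_unitExp]

theorem setIntegral_log_norm_add_sq {c : ℂ} (hc : ‖c‖ ≠ 1) :
    ∫ y in Icc (0 : ℝ) 1, log ‖c + unitExp y‖ ^ 2 = logSqMean ‖c‖ := by
  rw [integral_Icc_eq_integral_Ioc, ← integral_of_le zero_le_one, integral_log_norm_add_sq hc]

theorem abs_logSqMean_le {a : ℝ} (h0 : 0 ≤ a) (h2 : a ≤ 2) :
    |logSqMean a| ≤ log 2 ^ 2 + halfDilogSq 1 := by
  unfold logSqMean
  split_ifs with h
  · rw [abs_of_nonneg (halfDilogSq_nonneg h0)]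
    have := halfDilogSq_le_halfDilogSq_one h0 h
    nlinarith [sq_nonneg (log 2)]
  · have h1 : 1 ≤ a := by linarith
    have hinv : 1 / a ≤ 1 := by rw [div_le_one (by linarith)]; exact h1
    have hn := halfDilogSq_nonneg (a := 1 / a) (by positivity)
    have hl := halfDilogSq_le_halfDilogSq_one (a := 1 / a) (by positivity) hinv
    rw [abs_of_nonneg (by positivity)]
    have := log_nonneg h1
    have : log a ≤ log 2 := log_le_log (by linarith) h2
    gcongr

/-- Tonelli: almost every fibre is continuous, and the fibre integrals are bounded because |1 +
e^{2πix}| ≤ 2. The excluded fibres, those with |c| = 1, form a null set. -/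
theorem integrable_log_norm_sq_prod :
    Integrable (fun p : ℝ × ℝ => log ‖1 + unitExp p.1 + unitExp p.2‖ ^ 2)
      ((volume.restrict (Icc 0 1)).prod (volume.restrict (Icc 0 1))) := by
  have hm : Measurable (fun p : ℝ × ℝ => log ‖1 + unitExp p.1 + unitExp p.2‖ ^ 2) := by
    have := continuous_unitExp.measurable
    fun_prop
  refine (integrable_prod_iff hm.aestronglyMeasurable).2 ⟨?_, ?_⟩
  · filter_upwards [ae_restrict_of_ae ae_norm_one_add_unitExp_ne_one] with x hx
    exact (((continuous_log_norm_add_unitExp hx).pow 2).continuousOn).integrableOn_compact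
      isCompact_Icc
  · have hmeas := hm.norm.aestronglyMeasurable (μ := (volume.restrict (Icc (0 : ℝ) 1)).prod
      (volume.restrict (Icc (0 : ℝ) 1))).integral_prod_right'
    refine Integrable.mono' (integrable_const (log 2 ^ 2 + halfDilogSq 1)) hmeas ?_
    filter_upwards [ae_restrict_of_ae ae_norm_one_add_unitExp_ne_one] with x hx
    simp only [norm_pow, Real.norm_eq_abs, sq_abs]
    rw [setIntegral_log_norm_add_sq hx]
    refine abs_logSqMean_le (norm_nonneg _) ?_
    rw [norm_one_add_unitExp]
    linarith [abs_cos_le_one (π * x)]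

theorem restrict_Icc_prod_eq :
    (volume.restrict (Icc (0 : ℝ) 1)).prod (volume.restrict (Icc (0 : ℝ) 1)) =
      (volume : Measure (ℝ × ℝ)).restrict (Icc 0 1 ×ˢ Icc 0 1) := by
  rw [Measure.prod_restrict, ← Measure.volume_eq_prod]

theorem finTwoArrow_preimage_Icc :
    (MeasurableEquiv.finTwoArrow : (Fin 2 → ℝ) ≃ᵐ ℝ × ℝ) ⁻¹' (Icc 0 1 ×ˢ Icc 0 1) =
      Icc (0 : Fin 2 → ℝ) 1 := by
  ext t
  simp [MeasurableEquiv.finTwoArrow, Pi.le_def, Fin.forall_fin_two]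

theorem integrableOn_multipleMahlerIntegrand_oneAddXAddY :
    IntegrableOn (multipleMahlerIntegrand (fun _ : Fin 2 => oneAddXAddY))
      (Icc (0 : Fin 2 → ℝ) 1) volume := by
  have h := integrable_log_norm_sq_prod
  rw [restrict_Icc_prod_eq] at h
  have h2 := ((volume_preserving_finTwoArrow ℝ).integrableOn_comp_preimage
    MeasurableEquiv.finTwoArrow.measurableEmbedding).2 h
  rw [finTwoArrow_preimage_Icc] at h2
  refine h2.congr_fun (fun t _ => ?_) measurableSet_Icc
  rw [multipleMahlerIntegrand_oneAddXAddY]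
  rfl

theorem higherMahler_two_eq_setIntegral :
    higherMahler 2 oneAddXAddY = ∫ x in Icc (0 : ℝ) 1, logSqMean (2 * |cos (π * x)|) := by
  have h2 := (volume_preserving_finTwoArrow ℝ).setIntegral_preimage_emb
    MeasurableEquiv.finTwoArrow.measurableEmbedding
    (fun p : ℝ × ℝ => log ‖1 + unitExp p.1 + unitExp p.2‖ ^ 2) (Icc 0 1 ×ˢ Icc 0 1)
  rw [finTwoArrow_preimage_Icc, ← restrict_Icc_prod_eq, integral_prod _
    integrable_log_norm_sq_prod] at h2
  rw [higherMahler, multipleMahler]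
  simp only [multipleMahlerIntegrand_oneAddXAddY]
  refine Eq.trans ?_ (h2.trans (integral_congr_ae ?_))
  · rfl
  · filter_upwards [ae_restrict_of_ae ae_norm_one_add_unitExp_ne_one] with x hx
    rw [setIntegral_log_norm_add_sq hx, norm_one_add_unitExp]

theorem intervalIntegrable_logSqMean_two_mul_abs_cos :
    IntervalIntegrable (fun x => logSqMean (2 * |cos (π * x)|)) volume 0 1 := by
  rw [intervalIntegrable_iff_integrableOn_Icc_of_le zero_le_one]
  refine integrable_log_norm_sq_prod.integral_prod_left.congr ?_
  filter_upwards [ae_restrict_of_ae ae_norm_one_add_unitExp_ne_one] with x hx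
  rw [setIntegral_log_norm_add_sq hx, norm_one_add_unitExp]

/-- The symmetry x ↦ 1 - x halves the interval, and φ = π/2 - πx turns the cosine into a sine. -/
theorem higherMahler_two_eq_integral :
    higherMahler 2 oneAddXAddY =
      2 / π * ∫ φ in (0 : ℝ)..π / 2, logSqMean (2 * sin φ) := by
  set h : ℝ → ℝ := fun x => logSqMean (2 * |cos (π * x)|) with hdef
  have hint := intervalIntegrable_logSqMean_two_mul_abs_cos
  have hsymm : ∀ x, h (1 - x) = h x := fun x => by
    simp only [hdef]
    rw [mul_sub, mul_one, cos_pi_sub, abs_neg]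
  have h1 : ∫ x in (1 / 2 : ℝ)..1, h x = ∫ x in (0 : ℝ)..1 / 2, h x := by
    have := integral_comp_sub_left (a := 0) (b := 1 / 2) h 1
    simp only [hsymm] at this
    rw [this]
    norm_num
  have h2 : ∫ φ in (0 : ℝ)..π / 2, logSqMean (2 * sin φ) = π * ∫ x in (0 : ℝ)..1 / 2, h x := by
    have := integral_comp_sub_mul (a := 0) (b := 1 / 2) (fun φ => logSqMean (2 * sin φ))
      pi_ne_zero (π / 2)
    rw [show π / 2 - π * (1 / 2) = 0 by ring, mul_zero, sub_zero, smul_eq_mul,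
      eq_inv_mul_iff_mul_eq₀ pi_ne_zero] at this
    rw [← this]
    congr 1
    refine integral_congr fun x hx => ?_
    rw [uIcc_of_le (by norm_num)] at hx
    simp only [hdef]
    rw [sin_pi_div_two_sub, abs_of_nonneg]
    have hp := pi_pos
    exact cos_nonneg_of_mem_Icc ⟨by nlinarith [hx.1], by nlinarith [hx.2]⟩
  have hsub : ∀ a b : ℝ, 0 ≤ a → a ≤ b → b ≤ 1 → IntervalIntegrable h volume a b :=
    fun a b ha hab hb => hint.mono_set (by
      rw [uIcc_of_le hab, uIcc_of_le zero_le_one]; exact Icc_subset_Icc ha hb)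
  rw [higherMahler_two_eq_setIntegral, integral_Icc_eq_integral_Ioc,
    ← integral_of_le zero_le_one, h2,
    ← integral_add_adjacent_intervals (b := 1 / 2) (hsub _ _ le_rfl (by norm_num) (by norm_num))
      (hsub _ _ (by norm_num) (by norm_num) le_rfl), h1]
  have := pi_ne_zero
  field_simp
  ring

end Torus

/-! ### Deformation in β, Fubini, and integration by parts. -/

section Kernel

open Real MeasureTheory Set Filter Topology intervalIntegral

/-- The derivative in `β` of a primitive connecting `log² (2 sin φ)` and the mean of
`log² |2 sin φ + w|` over the unit circle. -/
noncomputable def mahlerKernel (φ β : ℝ) : ℝ :=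
  (if β < φ then 2 * logTwoSin φ - logTwoSin (φ - β) - logTwoSin (φ + β)
    else logTwoSin (φ - β) + logTwoSin (φ + β)) * (cos β / sin β)

theorem measurable_mahlerKernel : Measurable fun p : ℝ × ℝ => mahlerKernel p.1 p.2 := by
  have h := measurable_logTwoSin
  unfold mahlerKernel
  refine Measurable.mul (Measurable.ite (measurableSet_lt measurable_snd measurable_fst) ?_ ?_) ?_
  · exact (((h.comp measurable_fst).const_mul 2).sub
      (h.comp (measurable_fst.sub measurable_snd))).sub
      (h.comp (measurable_fst.add measurable_snd))
  · exact (h.comp (measurable_fst.sub measurable_snd)).add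
      (h.comp (measurable_fst.add measurable_snd))
  · fun_prop

/-- This is the logarithm of sin(y - x) sin(y + x) = sin² y - sin² x. -/
theorem logTwoSin_sub_add_logTwoSin_add {x y : ℝ} (hx : 0 < x) (hxy : x < y) (hy : y ≤ π / 2) :
    logTwoSin (y - x) + logTwoSin (y + x) =
      2 * logTwoSin y + log (1 - (sin x / sin y) ^ 2) := by
  have hsy : 0 < sin y := sin_pos_of_pos_of_lt_pi (by linarith) (by linarith [pi_pos])
  have h1 : 0 < sin (y - x) := sin_pos_of_pos_of_lt_pi (by linarith) (by linarith [pi_pos])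
  have h2 : 0 < sin (y + x) := sin_pos_of_pos_of_lt_pi (by linarith) (by linarith [pi_pos])
  have h3 : 2 * sin (y - x) * (2 * sin (y + x)) =
      (2 * sin y) ^ 2 * (1 - (sin x / sin y) ^ 2) := by
    rw [sin_sub, sin_add]
    field_simp
    have := sin_sq_add_cos_sq y
    have := sin_sq_add_cos_sq x
    linear_combination sin y ^ 2 * this - sin x ^ 2 * sin_sq_add_cos_sq y
  have h4 : 1 - (sin x / sin y) ^ 2 ≠ 0 := fun h0 => by
    rw [h0, mul_zero] at h3
    have : 0 < 2 * sin (y - x) * (2 * sin (y + x)) := by positivity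
    linarith
  rw [logTwoSin, logTwoSin, logTwoSin, ← log_mul (by positivity) (by positivity), h3,
    log_mul (by positivity) h4, log_pow]
  norm_num

theorem mahlerKernel_of_lt {φ β : ℝ} (h0 : 0 < β) (h1 : β < φ) (h2 : φ ≤ π / 2) :
    mahlerKernel φ β = -log (1 - (sin β / sin φ) ^ 2) * (cos β / sin β) := by
  rw [mahlerKernel, if_pos h1]
  linear_combination -(cos β / sin β) * logTwoSin_sub_add_logTwoSin_add h0 h1 h2

theorem mahlerKernel_of_gt {φ β : ℝ} (h0 : 0 < φ) (h1 : φ < β) (h2 : β ≤ π / 2) :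
    mahlerKernel φ β =
      (2 * logTwoSin β + log (1 - (sin φ / sin β) ^ 2)) * (cos β / sin β) := by
  rw [mahlerKernel, if_neg h1.not_gt, ← logTwoSin_sub_add_logTwoSin_add h0 h1 h2,
    ← logTwoSin_neg (φ - β), neg_sub, add_comm φ β]

theorem sin_div_sin_mem_Ioo {x y : ℝ} (hx : 0 < x) (hxy : x < y) (hy : y ≤ π / 2) :
    sin x / sin y ∈ Ioo (0 : ℝ) 1 := by
  have hsx : 0 < sin x := sin_pos_of_pos_of_lt_pi hx (by linarith [pi_pos])
  have hsy : 0 < sin y := sin_pos_of_pos_of_lt_pi (by linarith) (by linarith [pi_pos])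
  exact ⟨by positivity, (div_lt_one hsy).2 (sin_lt_sin_of_lt_of_le_pi_div_two (by linarith) hy hxy)⟩

theorem log_one_sub_sq_nonpos {s : ℝ} (hs : s ∈ Ioo (0 : ℝ) 1) : log (1 - s ^ 2) ≤ 0 :=
  log_nonpos (by nlinarith [hs.1, hs.2]) (by nlinarith [hs.1])

theorem hasDerivAt_halfDilogSq_sin_div {φ β : ℝ} (h0 : 0 < β) (h1 : β < φ) (h2 : φ ≤ π / 2) :
    HasDerivAt (fun x => halfDilogSq (sin x / sin φ)) (mahlerKernel φ β) β := by
  have hs := sin_div_sin_mem_Ioo h0 h1 h2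
  have hsx : 0 < sin β := sin_pos_of_pos_of_lt_pi h0 (by linarith [pi_pos])
  have hsy : 0 < sin φ := sin_pos_of_pos_of_lt_pi (by linarith) (by linarith [pi_pos])
  have h := HasDerivAt.comp β (hasDerivAt_halfDilogSq hs.1 hs.2)
    ((hasDerivAt_sin β).div_const (sin φ))
  refine h.congr_deriv ?_
  rw [mahlerKernel_of_lt h0 h1 h2]
  field_simp

theorem hasDerivAt_logTwoSin_sq_add_halfDilogSq {φ β : ℝ} (h0 : 0 < φ) (h1 : φ < β)
    (h2 : β ≤ π / 2) :
    HasDerivAt (fun x => logTwoSin x ^ 2 + halfDilogSq (sin φ / sin x)) (mahlerKernel φ β) β := by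
  have hs := sin_div_sin_mem_Ioo h0 h1 h2
  have hsx : 0 < sin φ := sin_pos_of_pos_of_lt_pi h0 (by linarith [pi_pos])
  have hsy : 0 < sin β := sin_pos_of_pos_of_lt_pi (by linarith) (by linarith [pi_pos])
  have h := HasDerivAt.comp β (hasDerivAt_halfDilogSq hs.1 hs.2)
    ((hasDerivAt_const β (sin φ)).div (hasDerivAt_sin β) hsy.ne')
  refine (((hasDerivAt_logTwoSin hsy.ne').pow 2).add h).congr_deriv ?_
  rw [mahlerKernel_of_gt h0 h1 h2]
  simp only [Pi.div_apply]
  field_simp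
  ring

/-- The kernel is nonnegative for β < φ and its primitive is continuous up to the endpoints, so it
is integrable in spite of the singularity at β = φ, and its absolute integral equals its integral.
-/
theorem integral_mahlerKernel_of_le {φ b : ℝ} (hb : 0 < b) (h1 : b ≤ φ) (h2 : φ ≤ π / 2) :
    IntervalIntegrable (mahlerKernel φ) volume 0 b ∧
      ∫ β in (0 : ℝ)..b, mahlerKernel φ β = halfDilogSq (sin b / sin φ) ∧
      ∫ β in (0 : ℝ)..b, |mahlerKernel φ β| = halfDilogSq (sin b / sin φ) := by
  have hsy : 0 < sin φ := sin_pos_of_pos_of_lt_pi (by linarith) (by linarith [pi_pos])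
  have hcont : ContinuousOn (fun x => halfDilogSq (sin x / sin φ)) (Icc 0 b) := by
    refine continuousOn_halfDilogSq.comp (by fun_prop) fun x hx => ⟨?_, ?_⟩
    · exact div_nonneg (sin_nonneg_of_nonneg_of_le_pi hx.1 (by linarith [hx.2, pi_pos])) hsy.le
    · exact (div_le_one hsy).2 (sin_le_sin_of_le_of_le_pi_div_two (by linarith [hx.1, pi_pos]) h2
        (hx.2.trans h1))
  have hderiv : ∀ x ∈ Ioo 0 b,
      HasDerivAt (fun x => halfDilogSq (sin x / sin φ)) (mahlerKernel φ x) x := fun x hx =>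
    hasDerivAt_halfDilogSq_sin_div hx.1 (hx.2.trans_le h1) h2
  have hnn : ∀ x ∈ Ioo 0 b, 0 ≤ mahlerKernel φ x := fun x hx => by
    have hxφ := hx.2.trans_le h1
    rw [mahlerKernel_of_lt hx.1 hxφ h2]
    have hc : 0 < cos x := cos_pos_of_mem_Ioo ⟨by linarith [hx.1, pi_pos], by linarith⟩
    have hs : 0 < sin x := sin_pos_of_pos_of_lt_pi hx.1 (by linarith [pi_pos])
    exact mul_nonneg (neg_nonneg.2 (log_one_sub_sq_nonpos (sin_div_sin_mem_Ioo hx.1 hxφ h2)))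
      (by positivity)
  have hint : IntervalIntegrable (mahlerKernel φ) volume 0 b :=
    (intervalIntegrable_iff_integrableOn_Ioc_of_le hb.le).2
      (integrableOn_deriv_of_nonneg hcont hderiv hnn)
  have hval : ∫ β in (0 : ℝ)..b, mahlerKernel φ β = halfDilogSq (sin b / sin φ) := by
    rw [integral_eq_sub_of_hasDerivAt_of_le hb.le hcont hderiv hint]
    simp [halfDilogSq_zero]
  refine ⟨hint, hval, hval ▸ ?_⟩
  rw [integral_of_le hb.le, integral_of_le hb.le, integral_Ioc_eq_integral_Ioo,
    integral_Ioc_eq_integral_Ioo]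
  exact setIntegral_congr_fun measurableSet_Ioo fun x hx => abs_of_nonneg (hnn x hx)

theorem logTwoSin_nonpos {u : ℝ} (h0 : 0 < u) (h1 : u ≤ π / 6) : logTwoSin u ≤ 0 := by
  have hp := pi_pos
  refine log_nonpos ?_ ?_
  · have := sin_pos_of_pos_of_lt_pi h0 (by linarith)
    positivity
  · have := sin_le_sin_of_le_of_le_pi_div_two (by linarith) (by linarith) h1
    rw [sin_pi_div_six] at this
    linarith

/-- For φ < β ≤ π/6 both logarithms in the kernel are nonpositive, the first because 2 sin β ≤ 1.
The constant sign again gives integrability and the absolute integral. -/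
theorem integral_mahlerKernel_of_ge {φ : ℝ} (h0 : 0 < φ) (h1 : φ ≤ π / 6) :
    IntervalIntegrable (mahlerKernel φ) volume φ (π / 6) ∧
      ∫ β in φ..π / 6, mahlerKernel φ β =
        halfDilogSq (2 * sin φ) - logTwoSin φ ^ 2 - halfDilogSq 1 ∧
      ∫ β in φ..π / 6, |mahlerKernel φ β| =
        -(halfDilogSq (2 * sin φ) - logTwoSin φ ^ 2 - halfDilogSq 1) := by
  have hp := pi_pos
  have hsx : ∀ x ∈ Icc φ (π / 6), 0 < sin x := fun x hx =>
    sin_pos_of_pos_of_lt_pi (by linarith [hx.1]) (by linarith [hx.2])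
  have hφ : 0 < sin φ := hsx φ ⟨le_rfl, h1⟩
  have hcont : ContinuousOn (fun x => logTwoSin x ^ 2 + halfDilogSq (sin φ / sin x))
      (Icc φ (π / 6)) := by
    refine ContinuousOn.add (ContinuousOn.pow (fun x hx =>
      (continuousAt_logTwoSin (hsx x hx).ne').continuousWithinAt) 2)
      (continuousOn_halfDilogSq.comp
        (continuousOn_const.div continuous_sin.continuousOn fun x hx => (hsx x hx).ne')
        fun x hx => ⟨div_nonneg hφ.le (hsx x hx).le, ?_⟩)
    exact (div_le_one (hsx x hx)).2 (sin_le_sin_of_le_of_le_pi_div_two (by linarith)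
      (by linarith [hx.2]) hx.1)
  have hderiv : ∀ x ∈ Ioo φ (π / 6),
      HasDerivAt (fun x => logTwoSin x ^ 2 + halfDilogSq (sin φ / sin x))
        (mahlerKernel φ x) x := fun x hx =>
    hasDerivAt_logTwoSin_sq_add_halfDilogSq h0 hx.1 (by linarith [hx.2])
  have hnp : ∀ x ∈ Ioo φ (π / 6), mahlerKernel φ x ≤ 0 := fun x hx => by
    rw [mahlerKernel_of_gt h0 hx.1 (by linarith [hx.2])]
    have hc : 0 < cos x := cos_pos_of_mem_Ioo ⟨by linarith [hx.1], by linarith [hx.2]⟩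
    have hs := hsx x ⟨hx.1.le, hx.2.le⟩
    have hl := logTwoSin_nonpos (h0.trans hx.1) hx.2.le
    have hl' := log_one_sub_sq_nonpos
      (sin_div_sin_mem_Ioo h0 hx.1 (by linarith [hx.2] : x ≤ π / 2))
    exact mul_nonpos_of_nonpos_of_nonneg (by linarith) (by positivity)
  have hint : IntervalIntegrable (mahlerKernel φ) volume φ (π / 6) := by
    have := integrableOn_deriv_of_nonneg hcont.neg (fun x hx => (hderiv x hx).neg)
      (fun x hx => neg_nonneg.2 (hnp x hx))
    exact (intervalIntegrable_iff_integrableOn_Ioc_of_le h1).2 (by simpa using this.neg)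
  have hval : ∫ β in φ..π / 6, mahlerKernel φ β =
      halfDilogSq (2 * sin φ) - logTwoSin φ ^ 2 - halfDilogSq 1 := by
    rw [integral_eq_sub_of_hasDerivAt_of_le h1 hcont hderiv hint, div_self hφ.ne',
      logTwoSin_pi_div_six, sin_pi_div_six, div_div_eq_mul_div, div_one, mul_comm (sin φ)]
    ring
  refine ⟨hint, hval, hval ▸ ?_⟩
  rw [← intervalIntegral.integral_neg, integral_of_le h1, integral_of_le h1,
    integral_Ioc_eq_integral_Ioo, integral_Ioc_eq_integral_Ioo]
  exact setIntegral_congr_fun measurableSet_Ioo fun x hx => abs_of_nonpos (hnp x hx)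

/-- The two primitives fit together as the circle mean of log²|2 sin φ + 2 sin β · w|. The bound on
the absolute integral is integrable in φ, which is what Fubini needs. -/
theorem integral_mahlerKernel {φ : ℝ} (h0 : 0 < φ) (h2 : φ ≤ π / 2) :
    IntervalIntegrable (mahlerKernel φ) volume 0 (π / 6) ∧
      ∫ β in (0 : ℝ)..π / 6, mahlerKernel φ β = logSqMean (2 * sin φ) - logTwoSin φ ^ 2 ∧
      ∫ β in (0 : ℝ)..π / 6, |mahlerKernel φ β| ≤ logTwoSin φ ^ 2 + 2 * halfDilogSq 1 := by
  have hp := pi_pos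
  have hs : 0 < sin φ := sin_pos_of_pos_of_lt_pi h0 (by linarith)
  have hD1 := halfDilogSq_nonneg (zero_le_one (α := ℝ))
  rcases lt_or_ge (π / 6) φ with h | h
  · obtain ⟨h3, h4, h5⟩ := integral_mahlerKernel_of_le (by linarith) h.le h2
    have hlt := sin_lt_sin_of_lt_of_le_pi_div_two (by linarith) h2 h
    rw [sin_pi_div_six] at h4 h5 hlt
    have heq : 1 / 2 / sin φ = 1 / (2 * sin φ) := by rw [div_div]
    refine ⟨h3, ?_, ?_⟩
    · rw [h4, logSqMean, if_neg (by linarith), heq, logTwoSin]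
      ring
    · rw [h5, heq]
      have := halfDilogSq_le_halfDilogSq_one (a := 1 / (2 * sin φ)) (by positivity)
        ((div_le_one (by positivity)).2 (by linarith))
      nlinarith [sq_nonneg (logTwoSin φ)]
  · obtain ⟨h3, h4, h5⟩ := integral_mahlerKernel_of_le h0 le_rfl h2
    obtain ⟨k3, k4, k5⟩ := integral_mahlerKernel_of_ge h0 h
    have hle := sin_le_sin_of_le_of_le_pi_div_two (by linarith) (by linarith) h
    rw [sin_pi_div_six] at hle
    rw [div_self hs.ne'] at h4 h5
    refine ⟨h3.trans k3, ?_, ?_⟩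
    · rw [← integral_add_adjacent_intervals h3 k3, h4, k4, logSqMean, if_pos (by linarith)]
      ring
    · rw [← integral_add_adjacent_intervals h3.abs k3.abs, h5, k5]
      linarith [halfDilogSq_nonneg (a := 2 * sin φ) (by positivity)]

theorem integrable_mahlerKernel :
    Integrable (fun p : ℝ × ℝ => mahlerKernel p.1 p.2)
      ((volume.restrict (Ioc 0 (π / 2))).prod (volume.restrict (Ioc 0 (π / 6)))) := by
  have hp := pi_pos
  refine (integrable_prod_iff measurable_mahlerKernel.aestronglyMeasurable).2 ⟨?_, ?_⟩
  · filter_upwards [ae_restrict_mem measurableSet_Ioc] with φ hφ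
    exact (intervalIntegrable_iff_integrableOn_Ioc_of_le (by linarith)).1
      (integral_mahlerKernel hφ.1 hφ.2).1
  · have hmeas := measurable_mahlerKernel.norm.aestronglyMeasurable
      (μ := (volume.restrict (Ioc (0 : ℝ) (π / 2))).prod
      (volume.restrict (Ioc (0 : ℝ) (π / 6)))).integral_prod_right'
    refine Integrable.mono' (g := fun φ => logTwoSin φ ^ 2 + 2 * halfDilogSq 1) ?_ hmeas ?_
    · exact ((intervalIntegrable_iff_integrableOn_Ioc_of_le (by linarith)).1
        intervalIntegrable_sq_logTwoSin_pi_div_two).add (integrable_const _)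
    · filter_upwards [ae_restrict_mem measurableSet_Ioc] with φ hφ
      rw [norm_of_nonneg (integral_nonneg fun _ => norm_nonneg _),
        ← integral_of_le (by linarith)]
      exact (integral_mahlerKernel hφ.1 hφ.2).2.2

/-- After shifting variables only values of L remain. L is odd, so the piece below β contributes
L(2β); antisymmetry about π/2 cancels L(π/2 - β) against L(π/2 + β). -/
theorem integral_mahlerKernel_left {β : ℝ} (h0 : 0 < β) (h1 : β ≤ π / 2) :
    ∫ φ in (0 : ℝ)..π / 2, mahlerKernel φ β =
      (2 * logTwoSinInt (2 * β) - 2 * logTwoSinInt β) * (cos β / sin β) := by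
  have hii := intervalIntegrable_logTwoSin
  have hsub : ∀ a b : ℝ, IntervalIntegrable (fun φ => logTwoSin (φ - β)) volume a b :=
    fun a b => by simpa using (hii (a - β) (b - β)).comp_sub_right β
  have hadd : ∀ a b : ℝ, IntervalIntegrable (fun φ => logTwoSin (φ + β)) volume a b :=
    fun a b => by simpa using (hii (a + β) (b + β)).comp_add_right β
  have hA : EqOn (fun φ => (logTwoSin (φ - β) + logTwoSin (φ + β)) * (cos β / sin β))
      (fun φ => mahlerKernel φ β) (uIoc 0 β) := fun φ hφ => by
    rw [uIoc_of_le h0.le] at hφ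
    simp only [mahlerKernel]
    rw [if_neg (not_lt.2 hφ.2)]
  have hB : EqOn (fun φ => (2 * logTwoSin φ - logTwoSin (φ - β) - logTwoSin (φ + β)) *
      (cos β / sin β)) (fun φ => mahlerKernel φ β) (uIoc β (π / 2)) := fun φ hφ => by
    rw [uIoc_of_le h1] at hφ
    simp only [mahlerKernel]
    rw [if_pos hφ.1]
  have hAi := ((hsub 0 β).add (hadd 0 β)).mul_const (cos β / sin β)
  have hBi := ((((hii β (π / 2)).const_mul 2).sub (hsub β (π / 2))).sub
    (hadd β (π / 2))).mul_const (cos β / sin β)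
  rw [← integral_add_adjacent_intervals (hAi.congr hA) (hBi.congr hB),
    ← integral_congr_ae (Eventually.of_forall hA), ← integral_congr_ae (Eventually.of_forall hB),
    intervalIntegral.integral_mul_const, intervalIntegral.integral_mul_const,
    intervalIntegral.integral_add (hsub _ _) (hadd _ _),
    intervalIntegral.integral_sub (((hii _ _).const_mul 2).sub (hsub _ _)) (hadd _ _),
    intervalIntegral.integral_sub ((hii _ _).const_mul 2) (hsub _ _),
    intervalIntegral.integral_const_mul]
  simp only [integral_comp_sub_right logTwoSin, integral_comp_add_right logTwoSin,
    logTwoSinInt_sub]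
  have e1 : logTwoSinInt (π / 2 + β) = -logTwoSinInt (π / 2 - β) := by
    rw [← logTwoSinInt_pi_sub]; ring_nf
  have e2 : logTwoSinInt 0 = 0 := by simp [logTwoSinInt]
  rw [e1, logTwoSinInt_pi_div_two, zero_sub, logTwoSinInt_neg, zero_add, sub_self, e2, two_mul β]
  ring

theorem integral_logSqMean_eq_add :
    IntervalIntegrable (fun β => (2 * logTwoSinInt (2 * β) - 2 * logTwoSinInt β) *
      (cos β / sin β)) volume 0 (π / 6) ∧
    ∫ φ in (0 : ℝ)..π / 2, logSqMean (2 * sin φ) = logTwoSinSqInt (π / 2) +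
      ∫ β in (0 : ℝ)..π / 6,
        (2 * logTwoSinInt (2 * β) - 2 * logTwoSinInt β) * (cos β / sin β) := by
  have hp := pi_pos
  have hint := integrable_mahlerKernel
  have e1 : ∀ᵐ φ ∂(volume.restrict (Ioc 0 (π / 2))),
      ∫ β in Ioc 0 (π / 6), mahlerKernel φ β = logSqMean (2 * sin φ) - logTwoSin φ ^ 2 := by
    filter_upwards [ae_restrict_mem measurableSet_Ioc] with φ hφ
    rw [← integral_of_le (by linarith), (integral_mahlerKernel hφ.1 hφ.2).2.1]
  have e2 : ∀ᵐ β ∂(volume.restrict (Ioc 0 (π / 6))),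
      ∫ φ in Ioc 0 (π / 2), mahlerKernel φ β =
        (2 * logTwoSinInt (2 * β) - 2 * logTwoSinInt β) * (cos β / sin β) := by
    filter_upwards [ae_restrict_mem measurableSet_Ioc] with β hβ
    rw [← integral_of_le (by linarith), integral_mahlerKernel_left hβ.1 (by linarith [hβ.2])]
  have h1 : IntervalIntegrable (fun φ => logSqMean (2 * sin φ) - logTwoSin φ ^ 2) volume
      0 (π / 2) :=
    (intervalIntegrable_iff_integrableOn_Ioc_of_le (by linarith)).2
      (hint.integral_prod_left.congr e1)
  have h2 := intervalIntegrable_sq_logTwoSin_pi_div_two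
  refine ⟨(intervalIntegrable_iff_integrableOn_Ioc_of_le (by linarith)).2
    (hint.integral_prod_right.congr e2), ?_⟩
  have hswap := integral_integral_swap (f := mahlerKernel) hint
  rw [integral_congr_ae e1, integral_congr_ae e2, ← integral_of_le (by linarith),
    ← integral_of_le (by linarith)] at hswap
  rw [← hswap, logTwoSinSqInt, ← intervalIntegral.integral_add h2 h1]
  simp

/-- Integrate by parts, with cot β as the derivative of ℓ(β). With a = ℓ(β), c = ℓ(π/2 - β), d = a +
c, the remaining integrand (4d - 2a)a equals 2d² - 2c², so no mixed product has to be integrated. -/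
theorem integral_logTwoSinInt_mul_cot :
    ∫ β in (0 : ℝ)..π / 6, (2 * logTwoSinInt (2 * β) - 2 * logTwoSinInt β) * (cos β / sin β) =
      2 * logTwoSinSqInt (π / 2) - 3 * logTwoSinSqInt (π / 3) := by
  have hp := pi_pos
  have hTint := integral_logSqMean_eq_add.1
  obtain ⟨hc, hcv⟩ := integral_logTwoSin_sq_pi_div_two_sub
  obtain ⟨hd, hdv⟩ := integral_logTwoSin_sq_two_mul
  have hderiv : ∀ x ∈ Ioo 0 (π / 6), HasDerivAt
      (fun β => (2 * logTwoSinInt (2 * β) - 2 * logTwoSinInt β) * logTwoSin β)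
      ((2 * logTwoSin (2 * x) ^ 2 - 2 * logTwoSin (π / 2 - x) ^ 2) +
        (2 * logTwoSinInt (2 * x) - 2 * logTwoSinInt x) * (cos x / sin x)) x := fun x hx => by
    have hs : sin x ≠ 0 := (sin_pos_of_pos_of_lt_pi hx.1 (by linarith [hx.2])).ne'
    have hs2 : sin (2 * x) ≠ 0 :=
      (sin_pos_of_pos_of_lt_pi (by linarith [hx.1]) (by linarith [hx.2])).ne'
    have h1 : HasDerivAt (fun β => logTwoSinInt (2 * β)) (logTwoSin (2 * x) * (2 * 1)) x :=
      HasDerivAt.comp x (hasDerivAt_logTwoSinInt hs2) ((hasDerivAt_id x).const_mul 2)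
    refine (((h1.const_mul 2).sub ((hasDerivAt_logTwoSinInt hs).const_mul 2)).mul
      (hasDerivAt_logTwoSin hs)).congr_deriv ?_
    rw [logTwoSin_two_mul hx.1 (by linarith [hx.2])]
    simp only [Pi.sub_apply]
    ring
  -- In L(2β)ℓ(β) the arguments do not match; replacing ℓ(β) by ℓ(2β) - ℓ(π/2 - β) leaves one
  -- matched product and one that is continuous at 0.
  have hlim0 : Tendsto (fun β => (2 * logTwoSinInt (2 * β) - 2 * logTwoSinInt β) * logTwoSin β)
      (𝓝[>] 0) (𝓝 0) := by
    have t1 := tendsto_logTwoSinInt_mul_logTwoSin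
    have t2 : Tendsto (fun β : ℝ => 2 * β) (𝓝[>] 0) (𝓝[>] 0) := by
      refine tendsto_nhdsWithin_iff.2 ⟨?_, ?_⟩
      · have : Tendsto (fun β : ℝ => 2 * β) (𝓝 0) (𝓝 (2 * 0)) :=
          (continuous_const_mul (2 : ℝ)).tendsto 0
        rw [mul_zero] at this
        exact this.mono_left nhdsWithin_le_nhds
      · filter_upwards [self_mem_nhdsWithin] with β hβ
        exact mul_pos two_pos (mem_Ioi.1 hβ)
    have t3 : Tendsto (fun β => logTwoSinInt (2 * β) * logTwoSin (π / 2 - β)) (𝓝[>] 0) (𝓝 0) := by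
      have hcs : ContinuousAt (fun β => logTwoSinInt (2 * β) * logTwoSin (π / 2 - β)) 0 := by
        refine ContinuousAt.mul ?_ ?_
        · exact (continuous_logTwoSinInt.comp (continuous_const_mul 2)).continuousAt
        · refine ContinuousAt.comp (g := logTwoSin) (continuousAt_logTwoSin ?_) (by fun_prop)
          simp
      have := hcs.tendsto
      simp only [mul_zero, logTwoSinInt, integral_same, zero_mul] at this
      exact this.mono_left nhdsWithin_le_nhds
    have := (((t1.comp t2).sub t3).const_mul 2).sub (t1.const_mul 2)
    simp only [sub_zero, mul_zero] at this
    refine this.congr' ?_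
    filter_upwards [Ioo_mem_nhdsGT (show (0 : ℝ) < π / 2 by linarith)] with β hβ
    simp only [Function.comp]
    rw [logTwoSin_two_mul hβ.1 hβ.2]
    ring
  have hlim1 : Tendsto (fun β => (2 * logTwoSinInt (2 * β) - 2 * logTwoSinInt β) * logTwoSin β)
      (𝓝[<] (π / 6)) (𝓝 0) := by
    have hcs : ContinuousAt
        (fun β => (2 * logTwoSinInt (2 * β) - 2 * logTwoSinInt β) * logTwoSin β) (π / 6) := by
      refine ContinuousAt.mul ?_ (continuousAt_logTwoSin (by simp))
      have := continuous_logTwoSinInt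
      fun_prop
    have := hcs.tendsto
    simp only [logTwoSin_pi_div_six, mul_zero] at this
    exact this.mono_left nhdsWithin_le_nhds
  have hFTC := integral_eq_sub_of_hasDerivAt_of_tendsto (by linarith : (0 : ℝ) < π / 6) hderiv
    (((hd.const_mul 2).sub (hc.const_mul 2)).add hTint) hlim0 hlim1
  rw [intervalIntegral.integral_add ((hd.const_mul 2).sub (hc.const_mul 2)) hTint,
    intervalIntegral.integral_sub (hd.const_mul 2) (hc.const_mul 2),
    intervalIntegral.integral_const_mul, intervalIntegral.integral_const_mul,
    hcv, hdv] at hFTC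
  linarith

theorem integral_logSqMean :
    ∫ φ in (0 : ℝ)..π / 2, logSqMean (2 * sin φ) =
      3 * logTwoSinSqInt (π / 2) - 3 * logTwoSinSqInt (π / 3) := by
  rw [integral_logSqMean_eq_add.2, integral_logTwoSinInt_mul_cot]
  ring

end Kernel

/-! ### A holomorphic primitive of log²(1 - z)/z and the values of S at π/2 and π/6. -/

section ComplexPrimitive

open Real MeasureTheory Set Filter Topology intervalIntegral

/-- The function `z ↦ log² (1 - z) / z`, extended analytically to `z = 0`. -/
noncomputable def logSqSlope : ℂ → ℂ := dslope (fun z : ℂ => Complex.log (1 - z) ^ 2) 0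

theorem re_lt_one_of_mem_ball {z : ℂ} (hz : z ∈ Metric.ball (-1 : ℂ) 2) : z.re < 1 := by
  rw [mem_ball_iff_norm, sub_neg_eq_add] at hz
  have := (Complex.abs_re_le_norm (z + 1)).trans_lt hz
  rw [Complex.add_re, Complex.one_re, abs_lt] at this
  linarith

theorem differentiableAt_log_one_sub_sq {z : ℂ} (hz : z.re < 1) :
    DifferentiableAt ℂ (fun z : ℂ => Complex.log (1 - z) ^ 2) z :=
  (((differentiableAt_id.const_sub 1).clog (Or.inl (by simpa using hz)))).pow 2

theorem logSqSlope_of_ne_zero {z : ℂ} (hz : z ≠ 0) :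
    logSqSlope z = Complex.log (1 - z) ^ 2 / z := by
  rw [logSqSlope, dslope_of_ne _ hz, slope_def_field]
  simp

theorem logSqSlope_zero : logSqSlope 0 = 0 := by
  have h1 : HasDerivAt (fun z : ℂ => Complex.log (1 - z)) (-1 / (1 - 0)) 0 :=
    ((hasDerivAt_id (0 : ℂ)).const_sub 1).clog (Or.inl (by simp))
  have h : HasDerivAt (fun z : ℂ => Complex.log (1 - z) ^ 2) 0 0 := by
    refine (h1.pow 2).congr_deriv ?_
    simp
  rw [logSqSlope, dslope_same, h.deriv]

theorem logSqSlope_ofReal_im {x : ℝ} (hx : x < 1) : (logSqSlope x).im = 0 := by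
  rcases eq_or_ne x 0 with rfl | h0
  · simp [logSqSlope_zero]
  · rw [logSqSlope_of_ne_zero (by exact_mod_cast h0)]
    have : Complex.log (1 - (x : ℂ)) ^ 2 / x = ((log (1 - x) ^ 2 / x : ℝ) : ℂ) := by
      push_cast
      rw [Complex.ofReal_log (by linarith)]
      push_cast
      rfl
    rw [this, Complex.ofReal_im]

/-- The disc |z + 1| < 2 contains the closed unit disc except the point 1 and lies in Re z < 1,
where 1 - z avoids the branch cut. -/
theorem exists_primitive_logSqSlope :
    ∃ g : ℂ → ℂ, g 0 = 0 ∧ ∀ z ∈ Metric.ball (-1 : ℂ) 2, HasDerivAt g (logSqSlope z) z := by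
  refine Complex.IsExactOn.with_val_at (DifferentiableOn.isExactOn_ball ?_) 0 0
  refine (Complex.differentiableOn_dslope (Metric.isOpen_ball.mem_nhds (by simp))).2 fun z hz => ?_
  exact (differentiableAt_log_one_sub_sq (re_lt_one_of_mem_ball hz)).differentiableWithinAt

theorem HasDerivAt.complex_im {f : ℝ → ℂ} {f' : ℂ} {x : ℝ} (h : HasDerivAt f f' x) :
    HasDerivAt (fun y => (f y).im) f'.im x :=
  Complex.imCLM.hasFDerivAt.comp_hasDerivAt x h

variable {g : ℂ → ℂ}

theorem ofReal_mem_ball {x : ℝ} (hx : x ∈ Ioo (-3 : ℝ) 1) : (x : ℂ) ∈ Metric.ball (-1 : ℂ) 2 := by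
  rw [mem_ball_iff_norm, sub_neg_eq_add,
    show (x : ℂ) + 1 = ((x + 1 : ℝ) : ℂ) by push_cast; ring, Complex.norm_real, Real.norm_eq_abs,
    abs_lt]
  constructor <;> linarith [hx.1, hx.2]

theorem im_primitive_ofReal (hg0 : g 0 = 0)
    (hg : ∀ z ∈ Metric.ball (-1 : ℂ) 2, HasDerivAt g (logSqSlope z) z) {x : ℝ}
    (hx : x ∈ Ioo (-3 : ℝ) 1) : (g x).im = 0 := by
  have h := (convex_Ioo (-3 : ℝ) 1).norm_image_sub_le_of_norm_hasDerivWithin_le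
    (f := fun y : ℝ => (g y).im) (f' := fun y : ℝ => (logSqSlope y).im) (C := 0) (x := 0) (y := x)
    (fun y hy => ((hg y (ofReal_mem_ball hy)).comp_ofReal).complex_im.hasDerivWithinAt)
    (fun y hy => by rw [logSqSlope_ofReal_im hy.2, norm_zero]) (by norm_num) hx
  rw [zero_mul] at h
  have := norm_le_zero_iff.1 h
  rw [sub_eq_zero] at this
  rw [this]
  simp [hg0]

theorem one_sub_exp_mul_I (θ : ℝ) :
    1 - Complex.exp (θ * Complex.I) =
      (2 * sin (θ / 2) : ℝ) * Complex.exp (((θ - π) / 2 : ℝ) * Complex.I) := by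
  rw [Complex.exp_mul_I, Complex.exp_mul_I, ← Complex.ofReal_cos, ← Complex.ofReal_sin,
    ← Complex.ofReal_cos, ← Complex.ofReal_sin, sub_div, cos_sub_pi_div_two, sin_sub_pi_div_two]
  have h1 : cos θ = 1 - 2 * sin (θ / 2) ^ 2 := by
    conv_lhs => rw [show θ = 2 * (θ / 2) by ring, cos_two_mul, cos_sq']
    ring
  have h2 : sin θ = 2 * sin (θ / 2) * cos (θ / 2) := by
    conv_lhs => rw [show θ = 2 * (θ / 2) by ring, sin_two_mul]
  rw [h1, h2]
  push_cast
  ring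

theorem log_one_sub_exp_mul_I {θ : ℝ} (h0 : 0 < θ) (h1 : θ < 2 * π) :
    Complex.log (1 - Complex.exp (θ * Complex.I)) =
      (logTwoSin (θ / 2) : ℝ) + ((θ - π) / 2 : ℝ) * Complex.I := by
  have hs : 0 < sin (θ / 2) := sin_pos_of_pos_of_lt_pi (by linarith) (by linarith)
  have hp := pi_pos
  have him : ((((θ - π) / 2 : ℝ) : ℂ) * Complex.I).im = (θ - π) / 2 := by
    rw [Complex.im_ofReal_mul, Complex.I_im, mul_one]
  rw [one_sub_exp_mul_I, Complex.log_ofReal_mul (by positivity) (Complex.exp_ne_zero _),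
    Complex.log_exp (by rw [him]; linarith) (by rw [him]; linarith), logTwoSin]

theorem exp_mul_I_mem_ball {θ : ℝ} (h : cos θ < 1) :
    Complex.exp (θ * Complex.I) ∈ Metric.ball (-1 : ℂ) 2 := by
  rw [mem_ball_iff_norm, sub_neg_eq_add, ← sq_lt_sq₀ (norm_nonneg _) (by norm_num),
    ← Complex.normSq_eq_norm_sq, Complex.normSq_apply]
  simp only [Complex.add_re, Complex.add_im, Complex.exp_ofReal_mul_I_re, Complex.one_re,
    Complex.one_im, Complex.exp_ofReal_mul_I_im]
  nlinarith [sin_sq_add_cos_sq θ]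

theorem cos_lt_one {θ : ℝ} (h0 : 0 < θ) (h1 : θ ≤ π) : cos θ < 1 := by
  have := cos_lt_cos_of_nonneg_of_le_pi le_rfl h1 h0
  rwa [cos_zero] at this

/-- Along z = e^{iθ} the derivative of g is i log²(1 - z), so its imaginary part is the real part of
(ℓ(θ/2) + i(θ - π)/2)². -/
theorem hasDerivAt_im_primitive_exp
    (hg : ∀ z ∈ Metric.ball (-1 : ℂ) 2, HasDerivAt g (logSqSlope z) z) {θ : ℝ} (h0 : 0 < θ)
    (h1 : θ ≤ π) :
    HasDerivAt (fun t : ℝ => (g (Complex.exp (t * Complex.I))).im)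
      (logTwoSin (θ / 2) ^ 2 - (π - θ) ^ 2 / 4) θ := by
  have hz := hg _ (exp_mul_I_mem_ball (cos_lt_one h0 h1))
  have hc : HasDerivAt (fun w : ℂ => g (Complex.exp (w * Complex.I))) _ (θ : ℂ) :=
    HasDerivAt.comp (θ : ℂ) hz (((hasDerivAt_id (θ : ℂ)).mul_const Complex.I).cexp)
  refine hc.comp_ofReal.complex_im.congr_deriv ?_
  simp only [id]
  rw [logSqSlope_of_ne_zero (Complex.exp_ne_zero _), ← mul_assoc,
    div_mul_cancel₀ _ (Complex.exp_ne_zero _), log_one_sub_exp_mul_I h0 (by linarith [pi_pos]),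
    one_mul, Complex.mul_I_im, sq, Complex.mul_re]
  simp only [Complex.add_re, Complex.add_im, Complex.ofReal_re, Complex.ofReal_im,
    Complex.re_ofReal_mul, Complex.im_ofReal_mul, Complex.I_re, Complex.I_im]
  ring

/-- The point e^{iπ/3} = 1 - e^{-iπ/3} is also reached from 0 along z = 1 - e^{-iφ}, where log(1 -
z) = -iφ is elementary. The imaginary part of g then has derivative φ²/2. -/
theorem im_primitive_one_sub_exp (hg0 : g 0 = 0)
    (hg : ∀ z ∈ Metric.ball (-1 : ℂ) 2, HasDerivAt g (logSqSlope z) z) :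
    (g (Complex.exp ((π / 3 : ℝ) * Complex.I))).im = π ^ 3 / 162 := by
  have hp := pi_pos
  have hball : ∀ φ ∈ Icc 0 (π / 3), 1 - Complex.exp (-φ * Complex.I) ∈ Metric.ball (-1 : ℂ) 2 := by
    intro φ hφ
    have hc := cos_le_cos_of_nonneg_of_le_pi hφ.1 (by linarith) hφ.2
    rw [cos_pi_div_three] at hc
    rw [mem_ball_iff_norm, sub_neg_eq_add, ← sq_lt_sq₀ (norm_nonneg _) (by norm_num),
      ← Complex.normSq_eq_norm_sq, Complex.normSq_apply, ← Complex.ofReal_neg]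
    simp only [Complex.add_re, Complex.add_im, Complex.sub_re, Complex.sub_im,
      Complex.exp_ofReal_mul_I_re, Complex.one_re, Complex.one_im, Complex.exp_ofReal_mul_I_im,
      cos_neg, sin_neg]
    nlinarith [sin_sq_add_cos_sq φ]
  have hder : ∀ φ ∈ Icc 0 (π / 3),
      HasDerivAt (fun t : ℝ => (g (1 - Complex.exp (-t * Complex.I))).im) (φ ^ 2 / 2) φ := by
    intro φ hφ
    have hc : HasDerivAt (fun w : ℂ => g (1 - Complex.exp (-w * Complex.I))) _ (φ : ℂ) :=
      HasDerivAt.comp (φ : ℂ) (hg _ (hball φ hφ))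
        ((((hasDerivAt_id (φ : ℂ)).neg.mul_const Complex.I).cexp).const_sub 1)
    refine hc.comp_ofReal.complex_im.congr_deriv ?_
    rcases hφ.1.eq_or_lt with rfl | hpos
    · simp [logSqSlope_zero]
    have hcl := cos_lt_one hpos (by linarith [hφ.2])
    have hne : 1 - Complex.exp (-φ * Complex.I) ≠ 0 := fun h => by
      have := congrArg Complex.re h
      rw [← Complex.ofReal_neg, Complex.sub_re, Complex.exp_ofReal_mul_I_re, cos_neg] at this
      simp at this
      linarith
    have him : (-(φ : ℂ) * Complex.I).im = -φ := by simp
    rw [logSqSlope_of_ne_zero hne, sub_sub_cancel, Complex.log_exp (by rw [him]; linarith [hφ.2])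
      (by rw [him]; linarith)]
    -- Only the real part -1/2, which does not depend on φ, enters the result.
    have hq : Complex.exp (-φ * Complex.I) / (1 - Complex.exp (-φ * Complex.I)) =
        ((-1 / 2 : ℝ) : ℂ) + ((-(sin φ / (2 * (1 - cos φ))) : ℝ) : ℂ) * Complex.I := by
      rw [div_eq_iff hne, ← Complex.ofReal_neg, Complex.exp_mul_I, ← Complex.ofReal_cos,
        ← Complex.ofReal_sin, cos_neg, sin_neg]
      have h1 : 1 - cos φ ≠ 0 := by linarith
      have hsc := sin_sq_add_cos_sq φ
      have hq1 : sin φ / (2 * (1 - cos φ)) * (2 * (1 - cos φ)) = sin φ :=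
        div_mul_cancel₀ _ (by positivity)
      generalize sin φ / (2 * (1 - cos φ)) = q at hq1 ⊢
      generalize cos φ = c at h1 hsc hq1 ⊢
      generalize sin φ = s at hsc hq1 ⊢
      have hq2 : 2 * q * s = 1 + c := mul_left_cancel₀ h1 (by linear_combination s * hq1 + hsc)
      apply Complex.ext
      · simp
        linear_combination -hq2 / 2
      · simp
        linear_combination hq1 / 2
    have : (-(φ : ℂ) * Complex.I) ^ 2 / (1 - Complex.exp (-φ * Complex.I)) *
        -(Complex.exp (-φ * Complex.I) * (-1 * Complex.I)) =
        ((-(φ ^ 2) : ℝ) : ℂ) * (Complex.exp (-φ * Complex.I) /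
          (1 - Complex.exp (-φ * Complex.I)) * Complex.I) := by
      rw [mul_pow, Complex.I_sq]
      push_cast
      ring
    simp only [Pi.neg_apply, id]
    rw [this, hq, Complex.im_ofReal_mul, Complex.mul_I_im, Complex.add_re, Complex.re_ofReal_mul,
      Complex.ofReal_re, Complex.I_re]
    ring
  have hFTC := integral_eq_sub_of_hasDerivAt (a := 0) (b := π / 3)
    (fun x hx => hder x (by rwa [uIcc_of_le (by linarith)] at hx))
    (Continuous.intervalIntegrable (by fun_prop) _ _)
  rw [intervalIntegral.integral_div, integral_pow] at hFTC
  have he : 1 - Complex.exp (-((π / 3 : ℝ) : ℂ) * Complex.I) =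
      Complex.exp ((π / 3 : ℝ) * Complex.I) := by
    rw [← Complex.ofReal_neg, Complex.exp_mul_I, Complex.exp_mul_I, ← Complex.ofReal_cos,
      ← Complex.ofReal_sin, ← Complex.ofReal_cos, ← Complex.ofReal_sin, cos_neg, sin_neg,
      cos_pi_div_three]
    push_cast
    ring
  rw [he] at hFTC
  simp [hg0] at hFTC
  push_cast
  rw [← hFTC]
  ring

/-- The singular point z = 1 lies on the boundary of the disc. Since g is real on the real axis, it
suffices to compare e^{iθ} with cos θ: the segment has length at most θ and the integrand on it is
O(θ^{-1/2}). -/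
theorem tendsto_im_primitive_exp (hg0 : g 0 = 0)
    (hg : ∀ z ∈ Metric.ball (-1 : ℂ) 2, HasDerivAt g (logSqSlope z) z) :
    Tendsto (fun t : ℝ => (g (Complex.exp (t * Complex.I))).im) (𝓝[>] 0) (𝓝 0) := by
  have hp3 := pi_gt_three
  have hp4 := pi_lt_four
  have hlim : Tendsto (fun t : ℝ => 2 * (8 * (25 * (t / 2) ^ (-(1 / 2) : ℝ)) + 72) * t)
      (𝓝[>] 0) (𝓝 0) := by
    have hc : ContinuousAt (fun t : ℝ => 800 * (t / 2) ^ (1 / 2 : ℝ) + 144 * t) 0 := by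
      refine ContinuousAt.add (ContinuousAt.mul continuousAt_const ?_) (by fun_prop)
      exact ContinuousAt.rpow_const (by fun_prop) (Or.inr (by norm_num))
    have := hc.tendsto
    norm_num at this
    refine (this.mono_left nhdsWithin_le_nhds).congr' ?_
    filter_upwards [self_mem_nhdsWithin] with t ht
    have ht2 : 0 < t / 2 := half_pos ht
    have : (t / 2) ^ (1 / 2 : ℝ) = (t / 2) ^ (-(1 / 2) : ℝ) * (t / 2) := by
      conv_rhs => rw [← rpow_add_one ht2.ne']
      norm_num
    norm_num at this ⊢
    rw [this]
    ring
  refine squeeze_zero_norm' ?_ hlim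
  filter_upwards [Ioo_mem_nhdsGT (show (0 : ℝ) < 1 by norm_num)] with θ hθ
  have hcos1 : cos θ < 1 := cos_lt_one hθ.1 (by linarith [hθ.2])
  have hcosh : 1 / 2 ≤ cos θ := by
    rw [← cos_pi_div_three]
    exact cos_le_cos_of_nonneg_of_le_pi hθ.1.le (by linarith) (by linarith [hθ.2])
  have hsin0 : 0 ≤ sin θ := sin_nonneg_of_nonneg_of_le_pi hθ.1.le (by linarith [hθ.2])
  have hsinθ : sin θ ≤ θ := sin_le hθ.1.le
  -- The vertical segment from cos θ to e^{iθ}; being convex, it admits the mean value inequality.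
  set s : Set ℂ := {z | z.re = cos θ ∧ 0 ≤ z.im ∧ z.im ≤ sin θ} with hs
  have hconv : Convex ℝ s := by
    intro z hz w hw a b ha hb hab
    simp only [hs, mem_ofPred_eq] at hz hw ⊢
    simp only [Complex.add_re, Complex.add_im, Complex.smul_re, Complex.smul_im, smul_eq_mul]
    refine ⟨by rw [hz.1, hw.1, ← add_mul, hab, one_mul], by
      nlinarith [mul_nonneg ha hz.2.1, mul_nonneg hb hw.2.1], ?_⟩
    calc _ ≤ a * sin θ + b * sin θ := by gcongr; exacts [hz.2.2, hw.2.2]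
      _ = sin θ := by rw [← add_mul, hab, one_mul]
  have hsub : ∀ z ∈ s, z ∈ Metric.ball (-1 : ℂ) 2 := fun z hz => by
    obtain ⟨h1, h2, h3⟩ := hz
    rw [mem_ball_iff_norm, sub_neg_eq_add, ← sq_lt_sq₀ (norm_nonneg _) (by norm_num),
      ← Complex.normSq_eq_norm_sq, Complex.normSq_apply]
    simp only [Complex.add_re, Complex.add_im, Complex.one_re, Complex.one_im, h1]
    nlinarith [sin_sq_add_cos_sq θ]
  have hbound : ∀ z ∈ s, ‖logSqSlope z‖ ≤ 2 * (8 * (25 * (θ / 2) ^ (-(1 / 2) : ℝ)) + 72) := by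
    intro z hz
    obtain ⟨h1, h2, h3⟩ := hz
    have hzn : 1 / 2 ≤ ‖z‖ := by
      have := Complex.abs_re_le_norm z
      rw [h1] at this
      exact hcosh.trans ((le_abs_self _).trans this)
    have hz0 : z ≠ 0 := fun h => by simp [h] at hzn; linarith
    -- On the segment |1 - z| ≥ 1 - cos θ, so log|1 - z| is bounded below by 2ℓ(θ/2) - log 2.
    have hhalf : 1 - cos θ = (2 * sin (θ / 2)) ^ 2 / 2 := by
      conv_lhs => rw [show θ = 2 * (θ / 2) by ring, cos_two_mul, cos_sq']
      ring
    have hsin2 : 0 < sin (θ / 2) :=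
      sin_pos_of_pos_of_lt_pi (by linarith [hθ.1]) (by linarith [hθ.2])
    have hlow : 1 - cos θ ≤ ‖1 - z‖ := by
      have := Complex.re_le_norm (1 - z)
      rwa [Complex.sub_re, Complex.one_re, h1] at this
    have hup : ‖1 - z‖ ≤ 2 := by
      have := Complex.norm_le_abs_re_add_abs_im (1 - z)
      rw [Complex.sub_re, Complex.one_re, h1, Complex.sub_im, Complex.one_im, zero_sub, abs_neg,
        abs_of_nonneg h2, abs_of_pos (by linarith)] at this
      linarith [sin_le_one θ]
    have hl2 : log 2 < 1 := by linarith [log_two_lt_d9]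
    have hloglow : 2 * logTwoSin (θ / 2) - 1 ≤ log ‖1 - z‖ := by
      have := log_le_log (by linarith) hlow
      rw [hhalf, log_div (by positivity) (by norm_num), log_pow] at this
      push_cast at this
      change 2 * logTwoSin (θ / 2) - _ ≤ _ at this
      linarith
    have hlogup : log ‖1 - z‖ ≤ 1 := (log_le_log (by linarith) hup).trans hl2.le
    have hlogabs : |log ‖1 - z‖| ≤ 2 * |logTwoSin (θ / 2)| + 1 := by
      rw [abs_le]
      constructor
      · linarith [neg_abs_le (logTwoSin (θ / 2))]
      · linarith [abs_nonneg (logTwoSin (θ / 2))]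
    have hlog : ‖Complex.log (1 - z)‖ ≤ 2 * |logTwoSin (θ / 2)| + 6 := by
      have := Complex.norm_le_abs_re_add_abs_im (Complex.log (1 - z))
      rw [Complex.log_re, Complex.log_im] at this
      linarith [Complex.abs_arg_le_pi (1 - z)]
    have hsq := sq_logTwoSin_le (half_pos hθ.1) (by linarith [hθ.2] : θ / 2 ≤ π / 2)
    rw [logSqSlope_of_ne_zero hz0, norm_div, norm_pow]
    calc _ ≤ (2 * |logTwoSin (θ / 2)| + 6) ^ 2 / (1 / 2) := by gcongr
      _ = 2 * (2 * |logTwoSin (θ / 2)| + 6) ^ 2 := by ring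
      _ ≤ 2 * (8 * logTwoSin (θ / 2) ^ 2 + 72) := by
        nlinarith [sq_nonneg (2 * |logTwoSin (θ / 2)| - 6), sq_abs (logTwoSin (θ / 2))]
      _ ≤ _ := by gcongr
  have hmv := hconv.norm_image_sub_le_of_norm_hasDerivWithin_le (𝕜 := ℂ) (f := g)
    (f' := logSqSlope) (x := ((cos θ : ℝ) : ℂ)) (y := Complex.exp (θ * Complex.I))
    (fun z hz => (hg z (hsub z hz)).hasDerivWithinAt) hbound
    ⟨Complex.ofReal_re _, by simpa using hsin0⟩
    ⟨Complex.exp_ofReal_mul_I_re _, by simpa using hsin0⟩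
  have hdist : ‖Complex.exp (θ * Complex.I) - ((cos θ : ℝ) : ℂ)‖ ≤ θ := by
    rw [Complex.exp_mul_I, ← Complex.ofReal_cos, ← Complex.ofReal_sin, add_sub_cancel_left,
      norm_mul, Complex.norm_I, Complex.norm_real, mul_one, norm_of_nonneg hsin0]
    exact hsinθ
  have hreal := im_primitive_ofReal hg0 hg (x := cos θ) ⟨by linarith, hcos1⟩
  have him : (g (Complex.exp (θ * Complex.I))).im =
      (g (Complex.exp (θ * Complex.I)) - g ((cos θ : ℝ) : ℂ)).im := by
    rw [Complex.sub_im, hreal, sub_zero]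
  rw [him, Real.norm_eq_abs]
  refine (Complex.abs_im_le_norm _).trans (hmv.trans ?_)
  have := hθ.1
  gcongr

theorem integral_logTwoSin_half_sq_sub (hg0 : g 0 = 0)
    (hg : ∀ z ∈ Metric.ball (-1 : ℂ) 2, HasDerivAt g (logSqSlope z) z) {σ : ℝ} (h0 : 0 < σ)
    (h1 : σ ≤ π) :
    2 * logTwoSinSqInt (σ / 2) - (π ^ 3 - (π - σ) ^ 3) / 12 =
      (g (Complex.exp (σ * Complex.I))).im := by
  have hint : IntervalIntegrable (fun θ => logTwoSin (θ / 2) ^ 2) volume 0 σ := by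
    have := (intervalIntegrable_sq_logTwoSin (a := 0) (b := σ / 2) le_rfl (by linarith)
      (by linarith)).comp_mul_left (c := 1 / 2)
    convert! this using 2
    · ring_nf
    · simp
    · ring
  have hint2 : IntervalIntegrable (fun θ => (π - θ) ^ 2 / 4) volume 0 σ :=
    Continuous.intervalIntegrable (by fun_prop) _ _
  have hFTC := integral_eq_sub_of_hasDerivAt_of_tendsto h0
    (fun x hx => hasDerivAt_im_primitive_exp hg hx.1 (hx.2.le.trans h1)) (hint.sub hint2)
    (tendsto_im_primitive_exp hg0 hg)
    ((hasDerivAt_im_primitive_exp hg h0 h1).continuousAt.tendsto.mono_left nhdsWithin_le_nhds)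
  rw [intervalIntegral.integral_sub hint hint2, intervalIntegral.integral_div,
    integral_comp_sub_left (fun x => x ^ 2), integral_pow,
    integral_comp_div (fun u => logTwoSin u ^ 2) two_ne_zero, zero_div, smul_eq_mul,
    sub_zero (g _).im] at hFTC
  rw [← hFTC, logTwoSinSqInt]
  push_cast
  ring

/-- Here the endpoint is e^{iπ} = -1, where g is real. -/
theorem logTwoSinSqInt_pi_div_two : logTwoSinSqInt (π / 2) = π ^ 3 / 24 := by
  obtain ⟨g, hg0, hg⟩ := exists_primitive_logSqSlope
  have h := integral_logTwoSin_half_sq_sub hg0 hg pi_pos le_rfl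
  rw [Complex.exp_pi_mul_I, show (-1 : ℂ) = ((-1 : ℝ) : ℂ) by norm_num,
    im_primitive_ofReal hg0 hg (by norm_num)] at h
  linarith

theorem logTwoSinSqInt_pi_div_six : logTwoSinSqInt (π / 6) = 7 * π ^ 3 / 216 := by
  obtain ⟨g, hg0, hg⟩ := exists_primitive_logSqSlope
  have hp := pi_pos
  have h := integral_logTwoSin_half_sq_sub hg0 hg (σ := π / 3) (by linarith) (by linarith)
  rw [im_primitive_one_sub_exp hg0 hg, show π / 3 / 2 = π / 6 by ring] at h
  linarith

end ComplexPrimitive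

/-! ### The Clausen function as a log-sine integral. -/

section Clausen

open Real MeasureTheory Set Filter Topology intervalIntegral

/-- A lower bound uniform in r: after rotation by e^{-iθ} the imaginary part no longer involves r.
It supplies the dominating function in Abel's limit. -/
theorem sin_le_norm_one_sub_mul_exp {θ : ℝ} (r : ℝ) :
    sin θ ≤ ‖1 - r * Complex.exp (θ * Complex.I)‖ := by
  have h : 1 - r * Complex.exp (θ * Complex.I) =
      Complex.exp (θ * Complex.I) * (Complex.exp ((-θ : ℝ) * Complex.I) - r) := by
    rw [mul_sub, ← Complex.exp_add]
    push_cast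
    rw [neg_mul, add_neg_cancel, Complex.exp_zero]
    ring
  rw [h, norm_mul, Complex.norm_exp_ofReal_mul_I, one_mul]
  have := Complex.abs_im_le_norm (Complex.exp ((-θ : ℝ) * Complex.I) - r)
  rw [Complex.sub_im, Complex.exp_ofReal_mul_I_im, sin_neg, Complex.ofReal_im, sub_zero,
    abs_neg] at this
  exact (le_abs_self _).trans this

theorem hasSum_pow_mul_cos_div {r : ℝ} (h0 : 0 ≤ r) (h1 : r < 1) (θ : ℝ) :
    HasSum (fun n : ℕ => r ^ (n + 1) / ((n : ℝ) + 1) * cos (((n : ℝ) + 1) * θ))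
      (-log ‖1 - r * Complex.exp (θ * Complex.I)‖) := by
  have hz : ‖(r : ℂ) * Complex.exp (θ * Complex.I)‖ < 1 := by
    rwa [norm_mul, Complex.norm_exp_ofReal_mul_I, mul_one, Complex.norm_real, norm_of_nonneg h0]
  have h := Complex.hasSum_re (Complex.hasSum_taylorSeries_neg_log hz)
  rw [Complex.neg_re, Complex.log_re, ← hasSum_nat_add_iff' 1] at h
  simp only [Finset.range_one, Finset.sum_singleton, Nat.cast_zero, div_zero, Complex.zero_re,
    sub_zero] at h
  refine h.congr_fun fun n => ?_
  have : ((r : ℂ) * Complex.exp (θ * Complex.I)) ^ (n + 1) / ((n + 1 : ℕ) : ℂ) =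
      ((r ^ (n + 1) / ((n : ℝ) + 1) : ℝ) : ℂ) *
        Complex.exp ((((n : ℝ) + 1) * θ : ℝ) * Complex.I) := by
    rw [mul_pow, ← Complex.exp_nat_mul]
    push_cast
    rw [← mul_assoc ((n : ℂ) + 1)]
    ring
  rw [this, Complex.re_ofReal_mul, Complex.exp_ofReal_mul_I_re]

theorem hasSum_pow_mul_sin_div {r : ℝ} (h0 : 0 ≤ r) (h1 : r < 1) (σ : ℝ) :
    HasSum (fun n : ℕ => r ^ (n + 1) * (sin (((n : ℝ) + 1) * σ) / ((n : ℝ) + 1) ^ 2))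
      (-∫ θ in (0 : ℝ)..σ, log ‖1 - r * Complex.exp (θ * Complex.I)‖) := by
  have h := intervalIntegral.hasSum_integral_of_dominated_convergence (μ := volume)
    (a := 0) (b := σ)
    (F := fun (n : ℕ) (θ : ℝ) => r ^ (n + 1) / ((n : ℝ) + 1) * cos (((n : ℝ) + 1) * θ))
    (fun n _ => r ^ n) (fun n => Continuous.aestronglyMeasurable (by fun_prop))
    (fun n => Eventually.of_forall fun θ _ => ?_)
    (Eventually.of_forall fun θ _ => summable_geometric_of_lt_one h0 h1) (by simp)
    (Eventually.of_forall fun θ _ => hasSum_pow_mul_cos_div h0 h1 θ)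
  · rw [intervalIntegral.integral_neg] at h
    refine h.congr_fun fun n => ?_
    have hn : (n : ℝ) + 1 ≠ 0 := by positivity
    rw [intervalIntegral.integral_const_mul, integral_comp_mul_left cos hn, integral_cos]
    simp
    field_simp
  · rw [norm_mul, norm_of_nonneg (by positivity), Real.norm_eq_abs]
    calc _ ≤ r ^ (n + 1) / ((n : ℝ) + 1) * 1 := by gcongr; exact abs_cos_le_one _
      _ ≤ r ^ (n + 1) := by
        rw [mul_one]
        exact div_le_self (by positivity) (by linarith [n.cast_nonneg (α := ℝ)])
      _ ≤ r ^ n := pow_le_pow_of_le_one h0 h1.le (by omega)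

/-- Abel summation: integrate the Fourier series of -log|1 - re^{iθ}| termwise for r < 1, then let r
→ 1 on both sides by dominated convergence. -/
theorem clausenTwo_eq {σ : ℝ} (h0 : 0 < σ) (h1 : σ < π) :
    clausenTwo σ = -(2 * logTwoSinInt (σ / 2)) := by
  have hlt : ∀ᶠ r : ℝ in 𝓝[<] 1, r ∈ Ioo (0 : ℝ) 1 := Ioo_mem_nhdsLT zero_lt_one
  have hl2 : 0 < log 2 := log_pos one_lt_two
  have hL : Tendsto (fun r : ℝ => ∑' n : ℕ,
      r ^ (n + 1) * (sin (((n : ℝ) + 1) * σ) / ((n : ℝ) + 1) ^ 2)) (𝓝[<] 1)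
      (𝓝 (clausenTwo σ)) := by
    refine tendsto_tsum_of_dominated_convergence (summable_clausenTwo σ).norm (fun n => ?_) ?_
    · have : ContinuousAt (fun r : ℝ =>
          r ^ (n + 1) * (sin (((n : ℝ) + 1) * σ) / ((n : ℝ) + 1) ^ 2)) 1 := by fun_prop
      have := this.tendsto
      rw [one_pow, one_mul] at this
      exact this.mono_left nhdsWithin_le_nhds
    · filter_upwards [hlt] with r hr n
      rw [norm_mul, norm_of_nonneg (by have := hr.1; positivity : 0 ≤ r ^ (n + 1))]
      exact mul_le_of_le_one_left (norm_nonneg _) (pow_le_one₀ hr.1.le hr.2.le)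
  have hR : Tendsto (fun r : ℝ => ∫ θ in (0 : ℝ)..σ, log ‖1 - r * Complex.exp (θ * Complex.I)‖)
      (𝓝[<] 1) (𝓝 (∫ θ in (0 : ℝ)..σ, logTwoSin (θ / 2))) := by
    refine intervalIntegral.tendsto_integral_filter_of_dominated_convergence
      (fun θ => |logTwoSin θ| + log 2) (Eventually.of_forall fun r => ?_) ?_
      ((intervalIntegrable_logTwoSin _ _).abs.add (by simp)) ?_
    · exact Measurable.aestronglyMeasurable (by fun_prop)
    · filter_upwards [hlt] with r hr
      refine Eventually.of_forall fun θ hθ => ?_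
      rw [uIoc_of_le h0.le] at hθ
      have hs : 0 < sin θ := sin_pos_of_pos_of_lt_pi hθ.1 (hθ.2.trans_lt h1)
      have hlow := sin_le_norm_one_sub_mul_exp (θ := θ) r
      have hup : ‖1 - r * Complex.exp (θ * Complex.I)‖ ≤ 2 := by
        refine (norm_sub_le _ _).trans ?_
        rw [norm_mul, Complex.norm_exp_ofReal_mul_I, mul_one, Complex.norm_real,
          norm_of_nonneg hr.1.le, norm_one]
        linarith [hr.2]
      have h2 := log_le_log hs hlow
      have h3 := log_le_log (hs.trans_le hlow) hup
      have h4 : logTwoSin θ = log 2 + log (sin θ) := log_mul two_ne_zero hs.ne'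
      rw [Real.norm_eq_abs, abs_le]
      constructor
      · linarith [neg_abs_le (logTwoSin θ)]
      · linarith [abs_nonneg (logTwoSin θ)]
    · refine Eventually.of_forall fun θ hθ => ?_
      rw [uIoc_of_le h0.le] at hθ
      have hs : 0 < sin (θ / 2) :=
        sin_pos_of_pos_of_lt_pi (by linarith [hθ.1]) (by linarith [hθ.2, pi_pos])
      have hn : ‖1 - ((1 : ℝ) : ℂ) * Complex.exp (θ * Complex.I)‖ = 2 * sin (θ / 2) := by
        rw [Complex.ofReal_one, one_mul, one_sub_exp_mul_I, norm_mul,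
          Complex.norm_exp_ofReal_mul_I, mul_one, Complex.norm_real, norm_of_nonneg (by positivity)]
      have hc : ContinuousAt (fun r : ℝ => log ‖1 - r * Complex.exp (θ * Complex.I)‖) 1 := by
        refine ContinuousAt.log (by fun_prop) ?_
        rw [hn]
        positivity
      have := hc.tendsto
      rw [hn] at this
      exact this.mono_left nhdsWithin_le_nhds
  have h := tendsto_nhds_unique (hL.congr' (by
    filter_upwards [hlt] with r hr
    exact (hasSum_pow_mul_sin_div hr.1.le hr.2 σ).tsum_eq)) hR.neg
  rw [h, integral_comp_div logTwoSin two_ne_zero, zero_div, smul_eq_mul, logTwoSinInt]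

end Clausen

/-! ### Inverse tangent integrals at 1/√3. -/

section InverseTangent

open Real MeasureTheory Set Filter Topology intervalIntegral

theorem invTan_succ_eq_tsum (k : ℕ) (x : ℝ) :
    invTan (k + 1) x = ∑' n : ℕ, (-1) ^ n / (2 * (n : ℝ) + 1) ^ (k + 1) * x ^ (2 * n + 1) :=
  tsum_congr fun n => by ring

theorem hasDerivAt_invTan_succ_tsum (k : ℕ) {x : ℝ} (hx : |x| < 1) :
    HasDerivAt (invTan (k + 1)) (∑' n : ℕ, (-1) ^ n / (2 * (n : ℝ) + 1) ^ (k + 1) *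
      (((2 * n + 1 : ℕ) : ℝ) * x ^ (2 * n + 1 - 1))) x := by
  rw [show invTan (k + 1) = _ from funext (invTan_succ_eq_tsum k)]
  refine hasDerivAt_tsum_mul_pow (k := fun n => 2 * n + 1) (fun n => by omega) (fun n => ?_) hx
  have h1 : (1 : ℝ) ≤ 2 * n + 1 := by linarith [n.cast_nonneg (α := ℝ)]
  rw [abs_div, abs_pow, abs_neg, abs_one, one_pow, abs_of_nonneg (by positivity)]
  push_cast
  rw [one_div_mul_eq_div, div_le_one (by positivity)]
  exact le_self_pow₀ h1 (by omega)

theorem hasDerivAt_invTan_succ (k : ℕ) {x : ℝ} (hx : |x| < 1) (h0 : x ≠ 0) :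
    HasDerivAt (invTan (k + 1)) (invTan k x / x) x := by
  refine (hasDerivAt_invTan_succ_tsum k hx).congr_deriv ?_
  rw [invTan, ← tsum_div_const]
  refine tsum_congr fun n => ?_
  rw [Nat.add_sub_cancel]
  push_cast
  field_simp
  ring

theorem invTan_one {x : ℝ} (hx : |x| < 1) : invTan 1 x = arctan x := by
  rw [← (hasSum_arctan (x := x) hx).tsum_eq, invTan]
  refine tsum_congr fun n => ?_
  push_cast
  ring

theorem invTan_zero_right (k : ℕ) : invTan k 0 = 0 := by
  simp [invTan]

/-- The function `u ↦ log (tan u)` on `(0, π/2)`. -/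
noncomputable def logTan (u : ℝ) : ℝ := logTwoSin u - logTwoSin (π / 2 - u)

theorem hasDerivAt_logTan {u : ℝ} (h0 : 0 < u) (h1 : u < π / 2) :
    HasDerivAt logTan (1 / (sin u * cos u)) u := by
  have hs : 0 < sin u := sin_pos_of_pos_of_lt_pi h0 (by linarith)
  have hc : 0 < cos u := cos_pos_of_mem_Ioo ⟨by linarith, h1⟩
  have h : HasDerivAt (fun v => logTwoSin (π / 2 - v)) _ u :=
    HasDerivAt.comp (h₂ := logTwoSin) u (hasDerivAt_logTwoSin (by rw [sin_pi_div_two_sub]; exact hc.ne'))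
      ((hasDerivAt_id u).const_sub (π / 2))
  refine ((hasDerivAt_logTwoSin hs.ne').sub h).congr_deriv ?_
  rw [cos_pi_div_two_sub, sin_pi_div_two_sub]
  field_simp
  linear_combination sin_sq_add_cos_sq u

theorem logTan_pi_div_six : logTan (π / 6) = -(log 3 / 2) := by
  rw [logTan, logTwoSin_pi_div_six, logTwoSin_pi_div_two_sub, cos_pi_div_six, mul_div_cancel₀ _
    two_ne_zero, log_sqrt (by norm_num), zero_sub]

theorem intervalIntegrable_logTan (a b : ℝ) : IntervalIntegrable logTan volume a b := by
  refine (intervalIntegrable_logTwoSin a b).sub ?_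
  simpa using (intervalIntegrable_logTwoSin (π / 2 - a) (π / 2 - b)).comp_sub_left (π / 2)

theorem integral_logTan :
    ∫ u in (0 : ℝ)..π / 6, logTan u = logTwoSinInt (π / 6) + logTwoSinInt (π / 3) := by
  have h : IntervalIntegrable (fun u => logTwoSin (π / 2 - u)) volume 0 (π / 6) := by
    simpa using (intervalIntegrable_logTwoSin (π / 2) (π / 2 - π / 6)).comp_sub_left (π / 2)
  have := intervalIntegral.integral_sub (intervalIntegrable_logTwoSin 0 (π / 6)) h
  rw [integral_logTwoSin_pi_div_two_sub, show π / 2 - π / 6 = π / 3 by ring, sub_neg_eq_add] at this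
  exact this

/-- With log tan u = a - c and ℓ(2u) = a + c, the parallelogram identity (a - c)² = 2a² + 2c² - (a +
c)² removes the mixed product. -/
theorem integral_logTan_sq :
    IntervalIntegrable (fun u => logTan u ^ 2) volume 0 (π / 6) ∧
      ∫ u in (0 : ℝ)..π / 6, logTan u ^ 2 = 2 * logTwoSinSqInt (π / 6) +
        2 * (logTwoSinSqInt (π / 2) - logTwoSinSqInt (π / 3)) - logTwoSinSqInt (π / 3) / 2 := by
  have hp := pi_pos
  obtain ⟨hc, hcv⟩ := integral_logTwoSin_sq_pi_div_two_sub
  obtain ⟨hd, hdv⟩ := integral_logTwoSin_sq_two_mul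
  have ha : IntervalIntegrable (fun u => logTwoSin u ^ 2) volume 0 (π / 6) :=
    intervalIntegrable_sq_logTwoSin le_rfl (by linarith) (by linarith)
  have heq : EqOn (fun u => 2 * logTwoSin u ^ 2 + 2 * logTwoSin (π / 2 - u) ^ 2 -
      logTwoSin (2 * u) ^ 2) (fun u => logTan u ^ 2) (uIoc 0 (π / 6)) := fun u hu => by
    rw [uIoc_of_le (by linarith)] at hu
    simp only [logTan]
    rw [logTwoSin_two_mul hu.1 (by linarith [hu.2])]
    ring
  have hint := ((ha.const_mul 2).add (hc.const_mul 2)).sub hd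
  refine ⟨hint.congr heq, ?_⟩
  rw [← integral_congr_ae (Eventually.of_forall heq),
    intervalIntegral.integral_sub ((ha.const_mul 2).add (hc.const_mul 2)) hd,
    intervalIntegral.integral_add (ha.const_mul 2) (hc.const_mul 2),
    intervalIntegral.integral_const_mul, intervalIntegral.integral_const_mul, hcv, hdv]
  rfl

/-- Both limits follow from u^{1/2} log tan u → 0. They remove the boundary terms at 0 in the
integrations by parts below. -/
theorem tendsto_mul_logTan_sq : Tendsto (fun u => u * logTan u ^ 2) (𝓝[>] 0) (𝓝 0) ∧
    Tendsto (fun u => u * logTan u) (𝓝[>] 0) (𝓝 0) := by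
  have hp := pi_pos
  have hpow : ∀ a : ℝ, 0 < a → Tendsto (fun u : ℝ => u ^ a) (𝓝[>] 0) (𝓝 0) := fun a ha => by
    have := (continuousAt_rpow_const 0 a (Or.inr ha.le)).tendsto
    rw [zero_rpow ha.ne'] at this
    exact this.mono_left nhdsWithin_le_nhds
  have h1 : Tendsto (fun u : ℝ => u ^ (1 / 2 : ℝ) * logTwoSin u) (𝓝[>] 0) (𝓝 0) := by
    have hlim := (hpow (1 / 4) (by norm_num)).const_mul 5
    rw [mul_zero] at hlim
    refine squeeze_zero_norm' ?_ hlim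
    filter_upwards [Ioo_mem_nhdsGT (show (0 : ℝ) < π / 2 by linarith)] with u hu
    have hu0 := hu.1
    rw [norm_mul, norm_of_nonneg (by positivity), Real.norm_eq_abs]
    calc _ ≤ u ^ (1 / 2 : ℝ) * (5 * u ^ (-(1 / 4) : ℝ)) := by
          gcongr; exact abs_logTwoSin_le hu.1 hu.2.le
      _ = 5 * (u ^ (1 / 2 : ℝ) * u ^ (-(1 / 4) : ℝ)) := by ring
      _ = _ := by rw [← rpow_add hu0]; norm_num
  have h2 : Tendsto (fun u : ℝ => logTwoSin (π / 2 - u)) (𝓝[>] 0) (𝓝 (logTwoSin (π / 2))) := by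
    have : ContinuousAt (fun u : ℝ => logTwoSin (π / 2 - u)) 0 :=
      ContinuousAt.comp (g := logTwoSin) (continuousAt_logTwoSin (by simp)) (by fun_prop)
    have := this.tendsto
    rw [sub_zero] at this
    exact this.mono_left nhdsWithin_le_nhds
  have h3 : Tendsto (fun u : ℝ => u ^ (1 / 2 : ℝ) * logTan u) (𝓝[>] 0) (𝓝 0) := by
    have := h1.sub ((hpow (1 / 2) (by norm_num)).mul h2)
    rw [zero_mul, sub_zero] at this
    refine this.congr fun u => ?_
    rw [logTan]
    ring
  have hsq : ∀ᶠ u : ℝ in 𝓝[>] 0, u ^ (1 / 2 : ℝ) * u ^ (1 / 2 : ℝ) = u := by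
    filter_upwards [self_mem_nhdsWithin] with u hu
    rw [← rpow_add hu]
    norm_num
  constructor
  · have := h3.mul h3
    rw [zero_mul] at this
    refine this.congr' ?_
    filter_upwards [hsq] with u hu
    linear_combination logTan u ^ 2 * hu
  · have := (hpow (1 / 2) (by norm_num)).mul h3
    rw [zero_mul] at this
    refine this.congr' ?_
    filter_upwards [hsq] with u hu
    linear_combination logTan u * hu

theorem abs_tan_lt_one {u : ℝ} (h0 : 0 ≤ u) (h1 : u ≤ π / 6) : |tan u| < 1 := by
  have hp := pi_pos
  rw [abs_of_nonneg (tan_nonneg_of_nonneg_of_le_pi_div_two h0 (by linarith)), ← tan_pi_div_four]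
  exact tan_lt_tan_of_lt_of_lt_pi_div_two (by linarith) (by linarith) (by linarith)

theorem hasDerivAt_invTan_tan (k : ℕ) {u : ℝ} (h0 : 0 < u) (h1 : u ≤ π / 6) :
    HasDerivAt (fun v => invTan (k + 1) (tan v)) (invTan k (tan u) * (1 / (sin u * cos u))) u := by
  have hp := pi_pos
  have hs : 0 < sin u := sin_pos_of_pos_of_lt_pi h0 (by linarith)
  have hc : 0 < cos u := cos_pos_of_mem_Ioo ⟨by linarith, by linarith⟩
  have ht : tan u ≠ 0 := by rw [tan_eq_sin_div_cos]; positivity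
  have h : HasDerivAt (fun v => invTan (k + 1) (tan v)) _ u :=
    HasDerivAt.comp u (hasDerivAt_invTan_succ k (abs_tan_lt_one h0.le h1) ht)
      (hasDerivAt_tan hc.ne')
  refine h.congr_deriv ?_
  rw [tan_eq_sin_div_cos]
  field_simp

theorem tendsto_invTan_tan (k : ℕ) :
    Tendsto (fun u => invTan (k + 1) (tan u)) (𝓝[>] 0) (𝓝 0) := by
  have h : ContinuousAt (fun u => invTan (k + 1) (tan u)) 0 := by
    refine ContinuousAt.comp (g := invTan (k + 1)) ?_ (continuousAt_tan.2 (by simp))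
    rw [tan_zero]
    exact (hasDerivAt_invTan_succ_tsum k (by simp)).continuousAt
  have := h.tendsto
  rw [tan_zero, invTan_zero_right] at this
  exact this.mono_left nhdsWithin_le_nhds

/-- The inverse tangent factor is differentiable at 0 and vanishes there, so the product is u log
tan u times a convergent difference quotient. -/
theorem tendsto_logTan_mul_invTan_tan (k : ℕ) :
    Tendsto (fun u => logTan u * invTan (k + 1) (tan u)) (𝓝[>] 0) (𝓝 0) := by
  have hd : HasDerivAt (fun u => invTan (k + 1) (tan u)) _ 0 :=
    HasDerivAt.comp (h₂ := invTan (k + 1)) 0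
      (hasDerivAt_invTan_succ_tsum k (by rw [tan_zero]; simp)) (hasDerivAt_tan (by simp))
  have hs := (hasDerivAt_iff_tendsto_slope.1 hd).mono_left
    (nhdsWithin_mono 0 fun u (hu : 0 < u) => hu.ne')
  have := tendsto_mul_logTan_sq.2.mul hs
  rw [zero_mul] at this
  refine this.congr' ?_
  filter_upwards [self_mem_nhdsWithin] with u hu
  have hu0 : u ≠ 0 := (mem_Ioi.1 hu).ne'
  rw [slope_def_field, tan_zero, invTan_zero_right, sub_zero, sub_zero]
  field_simp

/-- Since arctan(tan u) = u and d(log tan u) = du/(sin u cos u), one integration by parts leaves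
only the integral of log tan. -/
theorem invTan_two_one_div_sqrt_three :
    invTan 2 (1 / √3) =
      -(π / 12 * log 3) - (logTwoSinInt (π / 6) + logTwoSinInt (π / 3)) := by
  have hp := pi_pos
  have hd : ∀ u ∈ Ioc 0 (π / 6), HasDerivAt (fun v => v * logTan v - invTan 2 (tan v))
      (logTan u) u := fun u hu => by
    have h1 := (hasDerivAt_id u).mul (hasDerivAt_logTan hu.1 (by linarith [hu.2]))
    refine (h1.sub (hasDerivAt_invTan_tan 1 hu.1 hu.2)).congr_deriv ?_
    rw [invTan_one (abs_tan_lt_one hu.1.le hu.2), arctan_tan (by linarith [hu.1])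
      (by linarith [hu.2])]
    simp
  have hlim := tendsto_mul_logTan_sq.2.sub (tendsto_invTan_tan 1)
  rw [sub_zero] at hlim
  have h := integral_eq_sub_of_hasDerivAt_of_tendsto (by linarith : (0 : ℝ) < π / 6)
    (fun u hu => hd u ⟨hu.1, hu.2.le⟩) (intervalIntegrable_logTan _ _) hlim
    ((hd (π / 6) ⟨by linarith, le_rfl⟩).continuousAt.tendsto.mono_left nhdsWithin_le_nhds)
  rw [integral_logTan, logTan_pi_div_six, tan_pi_div_six] at h
  linarith

/-- Two integrations by parts: 2 Ti₃(tan u) - 2 log tan u · Ti₂(tan u) + u log² tan u has derivative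
log² tan u. -/
theorem invTan_three_one_div_sqrt_three :
    invTan 3 (1 / √3) = -(log 3 / 2 * invTan 2 (1 / √3)) - π / 48 * log 3 ^ 2 +
      (∫ u in (0 : ℝ)..π / 6, logTan u ^ 2) / 2 := by
  have hp := pi_pos
  have hd : ∀ u ∈ Ioc 0 (π / 6), HasDerivAt
      (fun v => 2 * invTan 3 (tan v) - 2 * (logTan v * invTan 2 (tan v)) + v * logTan v ^ 2)
      (logTan u ^ 2) u := fun u hu => by
    have ht := hasDerivAt_logTan hu.1 (by linarith [hu.2])
    refine ((((hasDerivAt_invTan_tan 2 hu.1 hu.2).const_mul 2).sub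
      ((ht.mul (hasDerivAt_invTan_tan 1 hu.1 hu.2)).const_mul 2)).add
      ((hasDerivAt_id u).mul (ht.pow 2))).congr_deriv ?_
    rw [invTan_one (abs_tan_lt_one hu.1.le hu.2), arctan_tan (by linarith [hu.1])
      (by linarith [hu.2])]
    simp
    ring
  have hlim := (((tendsto_invTan_tan 2).const_mul 2).sub
    ((tendsto_logTan_mul_invTan_tan 1).const_mul 2)).add tendsto_mul_logTan_sq.1
  simp only [mul_zero, sub_zero, add_zero] at hlim
  have h := integral_eq_sub_of_hasDerivAt_of_tendsto (by linarith : (0 : ℝ) < π / 6)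
    (fun u hu => hd u ⟨hu.1, hu.2.le⟩) integral_logTan_sq.1 hlim
    ((hd (π / 6) ⟨by linarith, le_rfl⟩).continuousAt.tendsto.mono_left nhdsWithin_le_nhds)
  rw [logTan_pi_div_six, tan_pi_div_six] at h
  rw [h]
  ring

end InverseTangent

/-! ### Assembly of the closed forms. -/

section MainResult

open Real MeasureTheory Set Filter Topology intervalIntegral

theorem logSineIntegrand_three (θ : ℝ) : logSineIntegrand 3 θ = logTwoSin (θ / 2) ^ 2 := by
  rw [logSineIntegrand, log_abs, logTwoSin]

theorem intervalIntegrable_logSineIntegrand_three :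
    IntervalIntegrable (logSineIntegrand 3) volume 0 (2 * π / 3) := by
  have hp := pi_pos
  have := (intervalIntegrable_sq_logTwoSin (a := 0) (b := π / 3) le_rfl (by linarith)
    (by linarith)).comp_mul_left (c := 1 / 2)
  rw [zero_div, show π / 3 / (1 / 2) = 2 * π / 3 by ring] at this
  rwa [show logSineIntegrand 3 = fun x => logTwoSin (1 / 2 * x) ^ 2 from
    funext fun θ => by rw [logSineIntegrand_three, one_div_mul_eq_div]]

theorem logSine_three : logSine 3 (2 * π / 3) = -(2 * logTwoSinSqInt (π / 3)) := by
  rw [logSine]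
  simp only [logSineIntegrand_three]
  rw [integral_comp_div (fun u => logTwoSin u ^ 2) two_ne_zero, zero_div, smul_eq_mul,
    show 2 * π / 3 / 2 = π / 3 by ring, logTwoSinSqInt]

theorem higherMahler_two_eq :
    higherMahler 2 oneAddXAddY = π ^ 2 / 4 - 6 / π * logTwoSinSqInt (π / 3) := by
  have := pi_ne_zero
  rw [higherMahler_two_eq_integral, integral_logSqMean, logTwoSinSqInt_pi_div_two]
  field_simp
  ring

/-- The integral of log² tan contains -5/2 · S(π/3) and enters Ti₃ with factor 1/2, so the weight
24/5 produces the -6 S(π/3) of the Mahler measure. The terms log 3 · L cancel by 3L(π/3) = 2L(π/6).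
-/
theorem invTan_three_eq :
    24 / 5 * invTan 3 (1 / √3) + 2 * log 3 * clausenTwo (π / 3) =
      π * log 3 ^ 2 / 10 + 16 * π ^ 3 / 45 - 6 * logTwoSinSqInt (π / 3) := by
  have hp := pi_pos
  have h := three_mul_logTwoSinInt_pi_div_three
  rw [clausenTwo_eq (by linarith) (by linarith), show π / 3 / 2 = π / 6 by ring,
    invTan_three_one_div_sqrt_three, invTan_two_one_div_sqrt_three, integral_logTan_sq.2,
    logTwoSinSqInt_pi_div_two, logTwoSinSqInt_pi_div_six]
  linear_combination (4 / 5 * log 3) * h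

/-- Monotonicity of S suffices: S(π/3) ≥ S(π/6) = 7π³/216 bounds the measure above by π²/18 =
3π²/54. -/
theorem higherMahler_two_ne : higherMahler 2 oneAddXAddY ≠ 5 * π ^ 2 / 54 := by
  have hp := pi_pos
  have h1 := logTwoSinSqInt_sub (a := π / 6) (b := π / 3) (by linarith) (by linarith)
    (by linarith)
  have h2 : 0 ≤ ∫ u in π / 6..π / 3, logTwoSin u ^ 2 :=
    intervalIntegral.integral_nonneg (by linarith) fun u _ => sq_nonneg _
  rw [higherMahler_two_eq]
  intro h
  field_simp at h
  rw [h1, logTwoSinSqInt_pi_div_six] at h2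
  nlinarith [pow_pos hp 3]

end MainResult

theorem mainTheorem2 :
    MeasureTheory.IntegrableOn (multipleMahlerIntegrand (fun _ : Fin 2 => oneAddXAddY))
      (Set.Icc (0 : Fin 2 → ℝ) 1) MeasureTheory.volume ∧
    IntervalIntegrable (logSineIntegrand 3) MeasureTheory.volume 0 (2 * Real.pi / 3) ∧
    higherMahler 2 oneAddXAddY
      = 24 / (5 * Real.pi) * invTan 3 (1 / Real.sqrt 3)
        + 2 * Real.log 3 / Real.pi * clausenTwo (Real.pi / 3)
        - Real.log 3 ^ 2 / 10 - 19 * Real.pi ^ 2 / 180 ∧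
    higherMahler 2 oneAddXAddY
      = Real.pi ^ 2 / 4 + 3 / Real.pi * logSine 3 (2 * Real.pi / 3) ∧
    higherMahler 2 oneAddXAddY ≠ 5 * Real.pi ^ 2 / 54 := by
  refine ⟨integrableOn_multipleMahlerIntegrand_oneAddXAddY,
    intervalIntegrable_logSineIntegrand_three, ?_, ?_, higherMahler_two_ne⟩
  · have h := invTan_three_eq
    have hp := Real.pi_ne_zero
    rw [higherMahler_two_eq]
    field_simp
    -- The factor is 4 · 5 · 10 · 180, the product of the cleared numerical denominators.
    linear_combination -36000 * h
  · rw [higherMahler_two_eq, logSine_three]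
    ring
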